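/- **Conventions.** For a skew shape $\lambda/\mu$ and $n\ge\ell(\lambda)$ let $\mathrm{JT}^n_{\lambda/\mu}(x)=\big(e_{\lambda_i-\mu_j-i+j}(x)\big)_{i,j=1}^n$, where $e_d(x)$ is the elementary symmetric function in the variables $x=(x_1,x_2,\dots)$, with $e_0=1$ and $e_d=0$ for $d<0$. Let $*$ be the entrywise product of matrices. The skew Schur function is $s_{\lambda/\mu}(x)=\det\big(e_{\lambda'_i-\mu'_j-i+j}(x)\big)_{i,j=1}^{\ell(\lambda')}$, and $(\lambda/\mu)'=\lambda'/\mu'$. A ribbon is a connected skew shape without a $2\times2$ block of cells; $\mathcal R_m$ is the set of ribbons $\lambda/\mu$ with $m$ cells and $\{i:\lambda_i>\mu_i\}=\{1,\dots,\ell(\lambda)\}$. Label the cells of a ribbon $R$ by $1,\dots,m$ along the ribbon, starting from the top-right cell; $\mathrm{Des}(R)$ is the set of $i$ such that cell $i$ is immediately above cell $i+1$. For a set $J$ of positive integers put $d(J,R)=\{\sum_{j=1}^i(\lambda_j-\mu_j): i\in J\}$. The Temperley–Lieb algebra $\mathrm{TL}_n(2)$ is the $\mathbb C$-algebra generated by $t_1,\dots,t_{n-1}$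 with relations $t_i^2=2t_i$, $t_it_jt_i=t_i$ if $|i-j|=1$, and $t_it_j=t_jt_i$ if $|i-j|\ge2$; its standard basis $\mathcal B_n$ is the set of Kauffman diagrams, multiplied by concatenation with a factor $2$ for each loop. Let $\theta:\mathbb C[\mathfrak S_n]\to\mathrm{TL}_n(2)$ be the algebra homomorphism with $\theta(s_i)=t_i-1$, where $s_i=(i,i+1)$ and permutations are composed from left to right. For $\tau\in\mathcal B_n$ put $\mathrm{imm}_\tau(M)=\sum_{w\in\mathfrak S_n}f_\tau(w)\,M_{1,w(1)}\cdots M_{n,w(n)}$, where $f_\tau(w)$ is the coefficient of $\tau$ in $\theta(w)$. For $I\subseteq\{1,\dots,n-1\}$ let $\tau(I)=\prod_{i\in I}t_i\in\mathcal B_n$, the product being taken in increasing order from left to right. **Theorem.** Let $k\ge1$, let $R=\lambda/\mu\in\mathcal R_m$, put $\ell=\ell(\lambda)$, and let $n\ge\ell$. 1. Let $I\subseteq\{1,\dots,\ell-1\}$. There is a ribbon $R_I\in\mathcal R_m$ with $\mathrm{Des}(R_I)=d(\{1,\dots,\ell-1\}\setminus I,\,R)$, and for every such $R_I=\rho/\pi$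 and every $N\ge\ell(\rho)$ $$\mathrm{imm}_{\tau(I)}\big(\mathrm{JT}^n_R(x^{(1)})*\cdots*\mathrm{JT}^n_R(x^{(k)})\big)=\det\big(\mathrm{JT}^N_{R_I}(x^{(1)})*\cdots*\mathrm{JT}^N_{R_I}(x^{(k)})\big).$$ In particular (the case $k=1$), $\mathrm{imm}_{\tau(I)}(\mathrm{JT}^n_R(x))=s_{(R_I)'}(x)$. 2. If $\tau\in\mathcal B_n$ is not of the form $\tau(I)$ with $I\subseteq\{1,\dots,\ell-1\}$, then $\mathrm{imm}_\tau(\mathrm{JT}^n_R(x))=0$. Hence every nonzero Temperley–Lieb immanant of a ribbon Jacobi–Trudi matrix $\mathrm{JT}^n_R(x)$ is a single ribbon Schur function. -/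

import Mathlib

namespace TLImm

section SymmetricGroup

/-! The symmetric group is presented by its simple transpositions: any family of elements of a
monoid satisfying the Coxeter relations extends to a homomorphism on permutations. This is used
only to construct the homomorphism `theta` below. -/

/-- The product `g k * g (k + 1) * ⋯ * g (n - 1)` (which is `1` for `n ≤ k`). -/
def descProd {M : Type*} [Monoid M] (g : ℕ → M) (k : ℕ) : ℕ → M
  | 0 => 1
  | n + 1 => if k ≤ n then descProd g k n * g n else 1

variable {M : Type*} [Monoid M]

theorem descProd_self (g : ℕ → M) (n : ℕ) : descProd g n n = 1 := by
  cases n <;> simp [descProd]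

theorem descProd_succ (g : ℕ → M) {k n : ℕ} (h : k ≤ n) :
    descProd g k (n + 1) = descProd g k n * g n := by simp [descProd, h]

theorem descProd_left (g : ℕ → M) {k n : ℕ} (h : k < n) :
    descProd g k n = g k * descProd g (k + 1) n := by
  induction n, h using Nat.le_induction with
  | base => simp [descProd_succ, descProd_self]
  | succ n hn ih => rw [descProd_succ g (by omega), ih, descProd_succ g hn, mul_assoc]

/-- The Coxeter relations of type A for `g 0, …, g (N - 1)`. -/
structure IsCox (g : ℕ → M) (N : ℕ) : Prop where
  sq : ∀ i, i < N → g i * g i = 1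
  braid : ∀ i, i + 1 < N → g i * g (i + 1) * g i = g (i + 1) * g i * g (i + 1)
  comm : ∀ i j, i + 2 ≤ j → j < N → g i * g j = g j * g i

theorem IsCox.comm_descProd {g : ℕ → M} {N : ℕ} (hg : IsCox g N) {i k n : ℕ} (hk : i + 2 ≤ k)
    (hn : n ≤ N) : g i * descProd g k n = descProd g k n * g i := by
  induction n with
  | zero => simp [descProd]
  | succ n ih =>
    by_cases h : k ≤ n
    · rw [descProd_succ g h, ← mul_assoc, ih (by omega), mul_assoc, hg.comm i n (by omega) (by omega),
        mul_assoc]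
    · simp [descProd, h]

theorem IsCox.shift_descProd {g : ℕ → M} {N : ℕ} (hg : IsCox g N) {i k n : ℕ} (hk : k ≤ i)
    (hin : i + 1 < n) (hn : n ≤ N) :
    g (i + 1) * descProd g k n = descProd g k n * g i := by
  induction n, hin using Nat.le_induction with
  | base =>
    rw [descProd_succ g (by omega), descProd_succ g hk]
    have : g (i + 1) * descProd g k i = descProd g k i * g (i + 1) := by
      have : ∀ j, j ≤ i → g (i + 1) * descProd g k j = descProd g k j * g (i + 1) := by
        intro j hj
        induction j with
        | zero => simp [descProd]
        | succ j ih =>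
          by_cases h : k ≤ j
          · rw [descProd_succ g h, ← mul_assoc, ih (by omega), mul_assoc,
              ← hg.comm j (i + 1) (by omega) (by omega), mul_assoc]
          · simp [descProd, h]
      exact this i le_rfl
    calc _ = (g (i + 1) * descProd g k i) * g i * g (i + 1) := by simp [mul_assoc]
      _ = descProd g k i * (g (i + 1) * g i * g (i + 1)) := by rw [this]; simp [mul_assoc]
      _ = _ := by rw [← hg.braid i (by omega)]; simp [mul_assoc]
  | succ n hn' ih =>
    rw [descProd_succ g (by omega), ← mul_assoc, ih (by omega), mul_assoc,
      hg.comm i n (by omega) (by omega), mul_assoc]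

/-- The submonoid generated by the first `n` generators -/
def genSub (g : ℕ → M) (n : ℕ) : Submonoid M := Submonoid.closure {x | ∃ i < n, x = g i}

theorem gen_mem (g : ℕ → M) {i n : ℕ} (h : i < n) : g i ∈ genSub g n :=
  Submonoid.subset_closure ⟨i, h, rfl⟩

theorem IsCox.normal_form {g : ℕ → M} {N : ℕ} (hg : IsCox g N) {n : ℕ} (hn : n + 1 ≤ N) {x : M}
    (hx : x ∈ genSub g (n + 1)) :
    ∃ k ≤ n + 1, ∃ y ∈ genSub g n, x = descProd g k (n + 1) * y := by
  refine Submonoid.closure_induction_left (s := {x | ∃ i < n + 1, x = g i})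
    (motive := fun x _ => ∃ k ≤ n + 1, ∃ y ∈ genSub g n, x = descProd g k (n + 1) * y)
    ⟨n + 1, le_rfl, 1, one_mem _, by simp [descProd_self]⟩ ?_ hx
  rintro _ ⟨i, hi, rfl⟩ _ _ ⟨k, hk, y, hy, rfl⟩
  rcases lt_trichotomy i k with h | rfl | h
  · rcases Nat.lt_or_ge (i + 1) k with h' | h'
    · refine ⟨k, hk, g i * y, mul_mem (gen_mem g (by omega)) hy, ?_⟩
      rw [← mul_assoc, hg.comm_descProd h' hn, mul_assoc]
    · obtain rfl : k = i + 1 := by omega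
      refine ⟨i, by omega, y, hy, ?_⟩
      rw [descProd_left g hi, mul_assoc]
  · refine ⟨i + 1, by omega, y, hy, ?_⟩
    rw [descProd_left g hi, ← mul_assoc, ← mul_assoc, hg.sq i (by omega), one_mul]
  · obtain ⟨i, rfl⟩ : ∃ j, i = j + 1 := ⟨i - 1, by omega⟩
    refine ⟨k, hk, g i * y, mul_mem (gen_mem g (by omega)) hy, ?_⟩
    rw [← mul_assoc, hg.shift_descProd (by omega) (by omega) hn, mul_assoc]

/-- The simple transposition `(i, i + 1)` of `ℕ`. -/
def natS (i : ℕ) : Equiv.Perm ℕ := Equiv.swap i (i + 1)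

theorem natS_cox (N : ℕ) : IsCox natS N where
  sq i _ := Equiv.swap_mul_self _ _
  braid i _ := by ext x; simp only [natS, Equiv.Perm.mul_apply, Equiv.swap_apply_def]; grind
  comm i j h _ := by ext x; simp only [natS, Equiv.Perm.mul_apply, Equiv.swap_apply_def]; grind

theorem descProd_natS {k n : ℕ} (h : k ≤ n) : descProd natS k n n = k := by
  induction h using Nat.decreasingInduction with
  | self => simp [descProd_self]
  | of_succ k h ih =>
    rw [descProd_left _ h, Equiv.Perm.mul_apply, ih]; simp [natS]

theorem eq_one_of_fst {A : Type*} [Monoid A] {T : ℕ → A} {N : ℕ} (hT : IsCox T N) {n : ℕ}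
    (hn : n ≤ N) (x : Equiv.Perm ℕ × A) (hx : x ∈ genSub (fun i => (natS i, T i)) n)
    (h1 : x.1 = 1) : x.2 = 1 := by
  have hg : IsCox (fun i => (natS i, T i)) N :=
    { sq := fun i hi => Prod.ext ((natS_cox N).sq i hi) (hT.sq i hi)
      braid := fun i hi => Prod.ext ((natS_cox N).braid i hi) (hT.braid i hi)
      comm := fun i j h hi => Prod.ext ((natS_cox N).comm i j h hi) (hT.comm i j h hi) }
  induction n generalizing x with
  | zero => simp [genSub] at hx; simp [hx]
  | succ n ih =>
    obtain ⟨k, hk, y, hy, rfl⟩ := hg.normal_form hn hx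
    have hfst : ∀ k m, (descProd (fun i => (natS i, T i)) k m).1 = descProd natS k m := by
      intro k m
      induction m with
      | zero => rfl
      | succ m ih => simp only [descProd]; split_ifs <;> simp [ih]
    have hfix : y.1 (n + 1) = n + 1 := by
      refine Submonoid.closure_induction (s := {x | ∃ i < n, x = (natS i, T i)})
        (motive := fun y _ => y.1 (n + 1) = n + 1) ?_ rfl ?_ hy
      · rintro _ ⟨i, hi, rfl⟩
        exact Equiv.swap_apply_of_ne_of_ne (by omega) (by omega)
      · intro a b _ _ ha hb
        simp [hb, ha]
    have hk' : k = n + 1 := by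
      have := congrArg (fun e : Equiv.Perm ℕ => e (n + 1)) h1
      simpa [hfst, hfix, descProd_natS hk] using this
    subst hk'
    rw [descProd_self, one_mul] at h1 ⊢
    exact ih (by omega) y hy h1

theorem IsCox.exists_inv {g : ℕ → M} {N : ℕ} (hg : IsCox g N) {x : M} (hx : x ∈ genSub g N) :
    ∃ y ∈ genSub g N, y * x = 1 ∧ x * y = 1 := by
  refine Submonoid.closure_induction (s := {x | ∃ i < N, x = g i})
    (motive := fun x _ => ∃ y ∈ genSub g N, y * x = 1 ∧ x * y = 1) ?_ ?_ ?_ hx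
  · rintro _ ⟨i, hi, rfl⟩
    exact ⟨g i, gen_mem g hi, hg.sq i hi, hg.sq i hi⟩
  · exact ⟨1, one_mem _, by simp⟩
  · rintro a b _ _ ⟨a', ha, h1, h2⟩ ⟨b', hb, h3, h4⟩
    refine ⟨b' * a', mul_mem hb ha, ?_, ?_⟩
    · rw [mul_assoc, ← mul_assoc a', h1, one_mul, h3]
    · rw [mul_assoc, ← mul_assoc b, h4, one_mul, h2]

theorem IsCox.pair {A : Type*} [Monoid A] {T : ℕ → A} {N : ℕ} (hT : IsCox T N) :
    IsCox (fun i => (natS i, T i)) N where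
  sq := fun i hi => Prod.ext ((natS_cox N).sq i hi) (hT.sq i hi)
  braid := fun i hi => Prod.ext ((natS_cox N).braid i hi) (hT.braid i hi)
  comm := fun i j h hi => Prod.ext ((natS_cox N).comm i j h hi) (hT.comm i j h hi)

theorem eq_snd_of_fst {A : Type*} [Monoid A] {T : ℕ → A} {N : ℕ} (hT : IsCox T N)
    {x y : Equiv.Perm ℕ × A} (hx : x ∈ genSub (fun i => (natS i, T i)) N)
    (hy : y ∈ genSub (fun i => (natS i, T i)) N) (h : x.1 = y.1) : x.2 = y.2 := by
  obtain ⟨z, hz, h1, h2⟩ := hT.pair.exists_inv hx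
  have h3 : (z * y).2 = 1 := eq_one_of_fst hT le_rfl _ (mul_mem hz hy)
    (by rw [Prod.fst_mul, ← h, ← Prod.fst_mul, h1]; rfl)
  calc x.2 = x.2 * (z * y).2 := by rw [h3, mul_one]
    _ = ((x * z) * y).2 := by simp [mul_assoc]
    _ = y.2 := by rw [h2, one_mul]

theorem exists_permHom {A : Type*} [Monoid A] (n : ℕ) (T : ℕ → A) (hT : IsCox T n) :
    ∃ φ : Equiv.Perm (Fin (n + 1)) →* A,
      ∀ i : Fin n, φ (Equiv.swap i.castSucc i.succ) = T i := by
  obtain ⟨ι, hι⟩ : ∃ ι : Equiv.Perm (Fin (n + 1)) →* Equiv.Perm ℕ,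
      ∀ i : Fin n, ι (Equiv.swap i.castSucc i.succ) = natS i := by
    let ι : Equiv.Perm (Fin (n + 1)) →* Equiv.Perm ℕ :=
      Equiv.Perm.viaEmbeddingHom (Fin.valEmbedding : Fin (n + 1) ↪ ℕ)
    refine ⟨ι, fun i => ?_⟩
    ext x
    by_cases hx : x < n + 1
    · have := Equiv.Perm.viaEmbedding_apply (Equiv.swap i.castSucc i.succ)
        (Fin.valEmbedding : Fin (n + 1) ↪ ℕ) ⟨x, hx⟩
      simp only [Fin.valEmbedding_apply] at this
      simp only [ι, Equiv.Perm.viaEmbeddingHom_apply, this, natS, Equiv.swap_apply_def, Fin.ext_iff,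
        Fin.val_castSucc, Fin.val_succ]
      split_ifs <;> simp
    · have := Equiv.Perm.viaEmbedding_apply_of_notMem (Equiv.swap i.castSucc i.succ)
        (Fin.valEmbedding : Fin (n + 1) ↪ ℕ) x (by rintro ⟨y, rfl⟩; exact hx y.2)
      simp only [ι, Equiv.Perm.viaEmbeddingHom_apply, this, natS]
      rw [Equiv.swap_apply_of_ne_of_ne] <;> omega
  have hex : ∀ w, ∃ a, (ι w, a) ∈ genSub (fun i => (natS i, T i)) n := by
    intro w
    have hw : w ∈ Submonoid.closure
        (Set.range fun i : Fin n => Equiv.swap i.castSucc i.succ) := by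
      rw [Equiv.Perm.mclosure_swap_castSucc_succ]; trivial
    refine Submonoid.closure_induction (motive := fun w _ =>
      ∃ a, (ι w, a) ∈ genSub (fun i => (natS i, T i)) n) ?_ ?_ ?_ hw
    · rintro _ ⟨i, rfl⟩
      exact ⟨T i, by rw [hι]; exact gen_mem (fun i => (natS i, T i)) i.2⟩
    · exact ⟨1, by rw [map_one]; exact one_mem _⟩
    · rintro a b _ _ ⟨a', ha⟩ ⟨b', hb⟩
      exact ⟨a' * b', by rw [map_mul]; exact mul_mem ha hb⟩
  choose f hf using hex
  refine ⟨⟨⟨f, ?_⟩, ?_⟩, ?_⟩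
  · exact eq_snd_of_fst hT (hf 1) (one_mem _) (by simp)
  · intro a b
    exact eq_snd_of_fst hT (hf _) (mul_mem (hf a) (hf b)) (by simp)
  · intro i
    exact eq_snd_of_fst hT (hf _) (gen_mem (fun i => (natS i, T i)) i.2) (hι i)

end SymmetricGroup

section Diagrams

/-- The `2 n` endpoints of a Kauffman diagram are the left points `A_1, …, A_n` (`Sum.inl`) and the
right points `B_1, …, B_n` (`Sum.inr`). `boundaryPos` numbers them by `0, …, 2 n - 1` in the order
`A_1, …, A_n, B_n, …, B_1` in which they occur on the boundary of their convex hull. -/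
def boundaryPos {n : ℕ} : Fin n ⊕ Fin n → ℕ
  | Sum.inl i => i
  | Sum.inr i => 2 * n - 1 - i

theorem boundaryPos_injective {n : ℕ} : Function.Injective (boundaryPos (n := n)) := by
  rintro (⟨i, hi⟩ | ⟨i, hi⟩) (⟨j, hj⟩ | ⟨j, hj⟩) h <;> simp only [boundaryPos] at h <;>
    simp <;> omega

/-- A Kauffman diagram: a perfect matching of the `2 n` endpoints (`partner` sends an endpoint to the
other end of its edge) such that no two edges cross inside the convex hull of the endpoints. -/
@[ext]
structure KauffmanDiagram (n : ℕ) where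
  partner : Equiv.Perm (Fin n ⊕ Fin n)
  partner_partner : ∀ v, partner (partner v) = v
  partner_ne : ∀ v, partner v ≠ v
  noncrossing : ∀ u v, ¬ (boundaryPos u < boundaryPos v ∧
    boundaryPos v < boundaryPos (partner u) ∧ boundaryPos (partner u) < boundaryPos (partner v))

variable {n : ℕ}

/-- The smaller of the two indices `i`, `i + 1` attached to the `i`-th generator. -/
def lo (i : Fin (n - 1)) : Fin n := ⟨i, by omega⟩
/-- The larger of the two indices `i`, `i + 1` attached to the `i`-th generator. -/
def hi (i : Fin (n - 1)) : Fin n := ⟨i + 1, by omega⟩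

/-- The diagram of the identity: every `A_i` is joined to `B_i`. -/
def KauffmanDiagram.one (n : ℕ) : KauffmanDiagram n where
  partner := Equiv.sumComm _ _
  partner_partner := by rintro (i | i) <;> rfl
  partner_ne := by rintro (i | i) <;> simp
  noncrossing := by
    rintro (⟨i, h₁⟩ | ⟨i, h₁⟩) (⟨j, h₂⟩ | ⟨j, h₂⟩) <;> simp [boundaryPos] <;> omega

/-- The matching `p` with `b`, `b'` joined to each other and their former partners joined to each
other (see `rewire_apply`); nothing changes if `b` and `b'` were already joined. -/
def rewire {α : Type*} [DecidableEq α] (p : Equiv.Perm α) (b b' : α) : Equiv.Perm α :=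
  Equiv.swap b' (p b) * p * Equiv.swap b' (p b)

theorem rewire_apply {α : Type*} [DecidableEq α] (p : Equiv.Perm α) (hp : ∀ x, p (p x) = x)
    (hne : ∀ x, p x ≠ x) {b b' : α} (hb : b ≠ b') (x : α) :
    rewire p b b' x = if x = b then b' else if x = b' then b else
      if x = p b then p b' else if x = p b' then p b else p x := by
  simp only [rewire, Equiv.Perm.mul_apply, Equiv.swap_apply_def]
  grind

theorem rewire_noncrossing {α : Type*} [DecidableEq α] (pos : α → ℕ)
    (hpos : Function.Injective pos) (p : Equiv.Perm α) (hp : ∀ x, p (p x) = x)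
    (hne : ∀ x, p x ≠ x)
    (hnc : ∀ u v, ¬ (pos u < pos v ∧ pos v < pos (p u) ∧ pos (p u) < pos (p v)))
    {b b' : α} (hb : pos b = pos b' + 1) (u v : α) :
    ¬ (pos u < pos v ∧ pos v < pos (rewire p b b' u) ∧
      pos (rewire p b b' u) < pos (rewire p b b' v)) := by
  have hbb : b ≠ b' := by rintro rfl; omega
  have key : ∀ x y, x ≠ y → pos x ≠ pos y := fun x y h h' => h (hpos h')
  have cr : ∀ x y, (pos x < pos y ∧ pos y < pos (p x) → pos (p y) < pos (p x) ∧ pos x < pos (p y)) := by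
    intro x y ⟨h1, h2⟩
    have h3 := hnc x y
    have h4 := hnc (p y) x
    have h5 := hp y
    rw [h5] at h4
    have : y ≠ p x := by rintro rfl; omega
    have : p y ≠ p x := by intro h; have := p.injective h; subst this; omega
    have := key _ _ this
    have : p y ≠ x := by rintro rfl; simp_all
    have := key _ _ this
    omega
  have side : ∀ z, z ≠ b → z ≠ b' → z ≠ p b → z ≠ p b' →
      ¬ (pos (p b) < pos z ∧ pos z < pos (p b') ∧ pos (p b') < pos (p z)) ∧
      ¬ (pos (p b') < pos z ∧ pos z < pos (p b) ∧ pos (p b) < pos (p z)) ∧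
      ¬ (pos z < pos (p b) ∧ pos (p b) < pos (p z) ∧ pos (p z) < pos (p b')) ∧
      ¬ (pos z < pos (p b') ∧ pos (p b') < pos (p z) ∧ pos (p z) < pos (p b)) := by
    intro z h1 h2 h3 h4
    have k1 := key _ _ h1
    have k2 := key _ _ h2
    have k3 := key _ _ h3
    have k4 := key _ _ h4
    have k5 : pos (p z) ≠ pos b := key _ _ fun h => h3 (by rw [← h, hp])
    have k6 : pos (p z) ≠ pos b' := key _ _ fun h => h4 (by rw [← h, hp])
    have a1 := cr b z
    have a2 := cr b (p z)
    have a3 := cr (p b) z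
    have a4 := cr (p b) (p z)
    have a5 := cr b' z
    have a6 := cr b' (p z)
    have a7 := cr (p b') z
    have a8 := cr (p b') (p z)
    simp only [hp] at a1 a2 a3 a4 a5 a6 a7 a8
    have k7 := key _ _ (hne b)
    have k8 := key _ _ (hne b')
    have k9 := key _ _ (hne z)
    have k10 : pos (p z) ≠ pos (p b) := key _ _ fun h => h1 (p.injective h)
    have k11 : pos (p z) ≠ pos (p b') := key _ _ fun h => h2 (p.injective h)
    refine ⟨?_, ?_, ?_, ?_⟩ <;> omega
  rw [rewire_apply p hp hne hbb, rewire_apply p hp hne hbb]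
  have su := side u
  have sv := side v
  have ku : u ≠ b → u ≠ p b → pos (p u) ≠ pos b := fun _ h => key _ _ fun h' => h (by rw [← h', hp])
  have hnuv := hnc u v
  split_ifs <;> subst_vars <;> grind

/-- The diagram obtained by concatenating `D` with the diagram of the generator `t_i` on its right
and removing a loop if one is formed: `B_i` and `B_{i+1}` get joined, and so do their former
partners. -/
def KauffmanDiagram.mulGen (D : KauffmanDiagram n) (i : Fin (n - 1)) : KauffmanDiagram n where
  partner := rewire D.partner (Sum.inr (lo i)) (Sum.inr (hi i))
  partner_partner v := by simp [rewire, D.partner_partner]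
  partner_ne v := by
    simp only [rewire, Equiv.Perm.mul_apply, ne_eq, Equiv.swap_apply_eq_iff]
    exact D.partner_ne _
  noncrossing := rewire_noncrossing _ boundaryPos_injective _ D.partner_partner D.partner_ne
    D.noncrossing (by simp only [boundaryPos, lo, hi]; omega)

/-- The factor arising in the concatenation of `D` with `t_i`: a loop is formed exactly if `D` joins
`B_i` and `B_{i+1}`, and it contributes the factor `ξ`. -/
noncomputable def KauffmanDiagram.loopFactor (ξ : ℂ) (D : KauffmanDiagram n) (i : Fin (n - 1)) : ℂ :=
  if D.partner (Sum.inr (lo i)) = Sum.inr (hi i) then ξ else 1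

theorem KauffmanDiagram.mulGen_apply (D : KauffmanDiagram n) (i : Fin (n - 1)) (x) :
    (D.mulGen i).partner x = if x = Sum.inr (lo i) then Sum.inr (hi i) else
      if x = Sum.inr (hi i) then Sum.inr (lo i) else
      if x = D.partner (Sum.inr (lo i)) then D.partner (Sum.inr (hi i)) else
      if x = D.partner (Sum.inr (hi i)) then D.partner (Sum.inr (lo i)) else D.partner x :=
  rewire_apply D.partner D.partner_partner D.partner_ne (by simp [lo, hi]) x

/-- Right multiplication by `t_i` on the space with basis the Kauffman diagrams. -/
noncomputable def actGen (ξ : ℂ) (i : Fin (n - 1)) :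
    Module.End ℂ (KauffmanDiagram n →₀ ℂ) :=
  Finsupp.linearCombination ℂ fun D => Finsupp.single (D.mulGen i) (D.loopFactor ξ i)

theorem actGen_single (ξ : ℂ) (i : Fin (n - 1)) (D : KauffmanDiagram n) (c : ℂ) :
    actGen ξ i (Finsupp.single D c) =
      Finsupp.single (D.mulGen i) (c * D.loopFactor ξ i) := by
  simp [actGen]

theorem actGen_sq (ξ : ℂ) (i : Fin (n - 1)) : actGen ξ i * actGen ξ i = ξ • actGen ξ i := by
  have hlh : (Sum.inr (lo i) : Fin n ⊕ Fin n) ≠ Sum.inr (hi i) := by simp [lo, hi]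
  refine Finsupp.lhom_ext fun D c => ?_
  simp only [Module.End.mul_apply, actGen_single, LinearMap.smul_apply, Finsupp.smul_single]
  have h1 : (D.mulGen i).mulGen i = D.mulGen i := by
    ext1; ext1 x
    simp only [KauffmanDiagram.mulGen_apply]
    grind
  have h2 : (D.mulGen i).loopFactor ξ i = ξ := by
    simp [KauffmanDiagram.loopFactor, KauffmanDiagram.mulGen_apply]
  rw [h1, h2, smul_eq_mul]; congr 1; ring

theorem actGen_braid (ξ : ℂ) (i j : Fin (n - 1)) (h : (i : ℕ) + 1 = j ∨ (j : ℕ) + 1 = i) :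
    actGen ξ i * (actGen ξ j * actGen ξ i) = actGen ξ i := by
  have hi' : (Sum.inr (lo i) : Fin n ⊕ Fin n) ≠ Sum.inr (hi i) := by simp [lo, hi]
  have hj' : (Sum.inr (lo j) : Fin n ⊕ Fin n) ≠ Sum.inr (hi j) := by simp [lo, hi]
  have hij : (hi i = lo j ∧ (Sum.inr (lo i) : Fin n ⊕ Fin n) ≠ Sum.inr (hi j)) ∨
      (hi j = lo i ∧ (Sum.inr (lo j) : Fin n ⊕ Fin n) ≠ Sum.inr (hi i)) := by
    simp [lo, hi]; omega
  refine Finsupp.lhom_ext fun D c => ?_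
  have e := D.partner_partner
  have ne := D.partner_ne
  have h1 : ((D.mulGen i).mulGen j).mulGen i = D.mulGen i := by
    ext1; ext1 x
    rcases hij with ⟨h, h'⟩ | ⟨h, h'⟩ <;>
    · simp only [KauffmanDiagram.mulGen_apply, h] at *
      grind
  have h2 : (D.mulGen i).loopFactor ξ j * ((D.mulGen i).mulGen j).loopFactor ξ i = 1 := by
    rcases hij with ⟨h, h'⟩ | ⟨h, h'⟩ <;>
    · simp only [KauffmanDiagram.loopFactor, KauffmanDiagram.mulGen_apply, h] at *
      grind
  simp only [Module.End.mul_apply, actGen_single]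
  rw [h1, mul_assoc, h2, mul_one]

theorem actGen_comm (ξ : ℂ) (i j : Fin (n - 1)) (h : (i : ℕ) + 2 ≤ j ∨ (j : ℕ) + 2 ≤ i) :
    actGen ξ i * actGen ξ j = actGen ξ j * actGen ξ i := by
  have hi' : (Sum.inr (lo i) : Fin n ⊕ Fin n) ≠ Sum.inr (hi i) := by simp [lo, hi]
  have hj' : (Sum.inr (lo j) : Fin n ⊕ Fin n) ≠ Sum.inr (hi j) := by simp [lo, hi]
  have g1 : (Sum.inr (lo i) : Fin n ⊕ Fin n) ≠ Sum.inr (hi j) := by simp [lo, hi]; omega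
  have g2 : (Sum.inr (lo i) : Fin n ⊕ Fin n) ≠ Sum.inr (lo j) := by
    simp [lo, Fin.ext_iff]; omega
  have g3 : (Sum.inr (hi i) : Fin n ⊕ Fin n) ≠ Sum.inr (hi j) := by
    simp [hi, Fin.ext_iff]; omega
  have g4 : (Sum.inr (hi i) : Fin n ⊕ Fin n) ≠ Sum.inr (lo j) := by simp [lo, hi]; omega
  refine Finsupp.lhom_ext fun D c => ?_
  have e := D.partner_partner
  have ne := D.partner_ne
  have h1 : (D.mulGen i).mulGen j = (D.mulGen j).mulGen i := by
    ext1; ext1 x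
    simp only [KauffmanDiagram.mulGen_apply, g1, g2, g3, g4, g1.symm, g2.symm, g3.symm, g4.symm,
      if_false]
    by_cases c1 : D.partner (Sum.inr (lo i)) = Sum.inr (lo j) <;>
    by_cases c2 : D.partner (Sum.inr (lo i)) = Sum.inr (hi j) <;>
    by_cases c3 : D.partner (Sum.inr (hi i)) = Sum.inr (lo j) <;>
    by_cases c4 : D.partner (Sum.inr (hi i)) = Sum.inr (hi j) <;>
    grind (splits := 20)
  have h2 : D.loopFactor ξ i * (D.mulGen i).loopFactor ξ j =
      D.loopFactor ξ j * (D.mulGen j).loopFactor ξ i := by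
    simp only [KauffmanDiagram.loopFactor, KauffmanDiagram.mulGen_apply]
    grind
  simp only [Module.End.mul_apply, actGen_single]
  rw [mul_assoc, mul_assoc, h1, h2]

end Diagrams

section TemperleyLieb

/-- The defining relations of the Temperley--Lieb algebra. The index `i : Fin (n - 1)` stands for
the generator written `t_{i+1}` when the generators are numbered from `1` to `n - 1`. -/
inductive TLRel (ξ : ℂ) (n : ℕ) :
    FreeAlgebra ℂ (Fin (n - 1)) → FreeAlgebra ℂ (Fin (n - 1)) → Prop
  | sq (i : Fin (n - 1)) :
      TLRel ξ n (FreeAlgebra.ι ℂ i * FreeAlgebra.ι ℂ i) (ξ • FreeAlgebra.ι ℂ i)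
  | braid (i j : Fin (n - 1)) (h : (i : ℕ) + 1 = j ∨ (j : ℕ) + 1 = i) :
      TLRel ξ n (FreeAlgebra.ι ℂ i * FreeAlgebra.ι ℂ j * FreeAlgebra.ι ℂ i) (FreeAlgebra.ι ℂ i)
  | comm (i j : Fin (n - 1)) (h : (i : ℕ) + 2 ≤ j ∨ (j : ℕ) + 2 ≤ i) :
      TLRel ξ n (FreeAlgebra.ι ℂ i * FreeAlgebra.ι ℂ j) (FreeAlgebra.ι ℂ j * FreeAlgebra.ι ℂ i)

/-- The Temperley--Lieb algebra `TL_n(ξ)`, by generators and relations. -/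
abbrev TL (ξ : ℂ) (n : ℕ) : Type := RingQuot (TLRel ξ n)

/-- The generators of `TL_n(ξ)`. -/
noncomputable def TL.t (ξ : ℂ) (n : ℕ) (i : Fin (n - 1)) : TL ξ n :=
  RingQuot.mkAlgHom ℂ (TLRel ξ n) (FreeAlgebra.ι ℂ i)

theorem TL.t_sq (ξ : ℂ) {n : ℕ} (i : Fin (n - 1)) : t ξ n i * t ξ n i = ξ • t ξ n i := by
  simpa [t] using RingQuot.mkAlgHom_rel ℂ (TLRel.sq (ξ := ξ) (n := n) i)

theorem TL.t_braid (ξ : ℂ) {n : ℕ} (i j : Fin (n - 1)) (h : (i : ℕ) + 1 = j ∨ (j : ℕ) + 1 = i) :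
    t ξ n i * t ξ n j * t ξ n i = t ξ n i := by
  simpa [t] using RingQuot.mkAlgHom_rel ℂ (TLRel.braid (ξ := ξ) (n := n) i j h)

theorem TL.t_comm (ξ : ℂ) {n : ℕ} (i j : Fin (n - 1)) (h : (i : ℕ) + 2 ≤ j ∨ (j : ℕ) + 2 ≤ i) :
    t ξ n i * t ξ n j = t ξ n j * t ξ n i := by
  simpa [t] using RingQuot.mkAlgHom_rel ℂ (TLRel.comm (ξ := ξ) (n := n) i j h)

/-- The right action of `TL_n(ξ)` on the space with basis the Kauffman diagrams, in which the
generators act by concatenation. -/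
noncomputable def TL.rightAction (ξ : ℂ) (n : ℕ) :
    TL ξ n →ₐ[ℂ] (Module.End ℂ (KauffmanDiagram n →₀ ℂ))ᵐᵒᵖ :=
  RingQuot.liftAlgHom ℂ
    ⟨FreeAlgebra.lift ℂ fun i => MulOpposite.op (actGen ξ i), by
      intro x y h
      cases h with
      | sq i => simp [← MulOpposite.op_mul, actGen_sq]
      | braid i j h => simp [← MulOpposite.op_mul, actGen_braid ξ i j h]
      | comm i j h => simp [← MulOpposite.op_mul, actGen_comm ξ i j h]⟩

theorem TL.rightAction_t (ξ : ℂ) {n : ℕ} (i : Fin (n - 1)) :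
    rightAction ξ n (t ξ n i) = MulOpposite.op (actGen ξ i) := by
  simp [rightAction, t]

/-- The expansion of an element `x` of `TL_n(ξ)` in the basis of Kauffman diagrams: `x` is
multiplied from the right to the identity diagram. The diagrams label a basis of `TL_n(ξ)` in such
a way that multiplication is concatenation, with a factor `ξ` for each loop, so that
`x = 1 * x` is the combination of basis elements given by `x.expand`. -/
noncomputable def TL.expand {ξ : ℂ} {n : ℕ} (x : TL ξ n) : KauffmanDiagram n →₀ ℂ :=
  (rightAction ξ n x).unop (Finsupp.single (KauffmanDiagram.one n) 1)

/-- The diagram of `τ(I) = ∏_{i ∈ I} t_i`, the product taken in increasing order from left to right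
(no loops are formed, see `TL.expand_prod_t`). An element `i : Fin (n - 1)` of `I` stands for the
element `i + 1` of `[n - 1] = {1, …, n - 1}`. -/
def tau {n : ℕ} (I : Finset (Fin (n - 1))) : KauffmanDiagram n :=
  (I.sort (· ≤ ·)).foldl KauffmanDiagram.mulGen (KauffmanDiagram.one n)

theorem TL.expand_prod_t {ξ : ℂ} {n : ℕ} (I : Finset (Fin (n - 1))) :
    TL.expand (((I.sort (· ≤ ·)).map (TL.t ξ n)).prod) = Finsupp.single (tau I) 1 := by
  have key : ∀ (l : List (Fin (n - 1))) (D : KauffmanDiagram n), l.Pairwise (· < ·) →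
      (∀ i ∈ l, D.partner (Sum.inr (hi i)) = Sum.inl (hi i)) →
      (rightAction ξ n ((l.map (TL.t ξ n)).prod)).unop (Finsupp.single D 1) =
        Finsupp.single (l.foldl KauffmanDiagram.mulGen D) 1 := by
    intro l
    induction l with
    | nil => intro D _ _; simp
    | cons i l ih =>
      intro D hl hD
      rw [List.pairwise_cons] at hl
      have hi1 := hD i (by simp)
      have hloop : D.loopFactor ξ i = 1 := by
        rw [KauffmanDiagram.loopFactor, if_neg]
        intro h
        have := D.partner_partner (Sum.inr (lo i))
        rw [h, hi1] at this
        cases this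
      simp only [List.map_cons, List.prod_cons, map_mul, rightAction_t, MulOpposite.unop_mul,
        Module.End.mul_apply, MulOpposite.unop_op, actGen_single, hloop, mul_one, List.foldl_cons]
      refine ih _ hl.2 fun j hj => ?_
      have hij := hl.1 j hj
      have hj1 := hD j (by simp [hj])
      rw [KauffmanDiagram.mulGen_apply, if_neg, if_neg, if_neg, if_neg, hj1]
      · intro h
        rw [h, D.partner_partner] at hj1
        cases hj1
      · intro h
        rw [h, D.partner_partner] at hj1
        cases hj1
      · simp only [hi, Sum.inr.injEq, Fin.ext_iff]; omega
      · simp only [hi, lo, Sum.inr.injEq, Fin.ext_iff]; omega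
  exact key _ _ (Finset.sortedLT_sort I).pairwise (fun i _ => rfl)

/-- The simple transposition `s_i = (i, i + 1)`. -/
def simpleTransposition {n : ℕ} (i : Fin (n - 1)) : Equiv.Perm (Fin n) := Equiv.swap (lo i) (hi i)

theorem exists_theta (n : ℕ) :
    ∃ θ : MonoidAlgebra ℂ (Equiv.Perm (Fin n))ᵐᵒᵖ →ₐ[ℂ] TL 2 n,
      ∀ i : Fin (n - 1), θ (MonoidAlgebra.of ℂ _ (MulOpposite.op (simpleTransposition i))) =
        TL.t 2 n i - 1 := by
  suffices h : ∃ φ : Equiv.Perm (Fin n) →* TL 2 n,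
      ∀ i : Fin (n - 1), φ (simpleTransposition i) = TL.t 2 n i - 1 by
    obtain ⟨φ, hφ⟩ := h
    refine ⟨MonoidAlgebra.lift ℂ _ _
      (φ.comp (MulEquiv.inv' (Equiv.Perm (Fin n))).symm.toMonoidHom), fun i => ?_⟩
    rw [MonoidAlgebra.of_apply, MonoidAlgebra.lift_single, one_smul, ← hφ]
    simp [simpleTransposition]
  cases n with
  | zero => exact ⟨1, fun i => i.elim0⟩
  | succ n =>
    let T : ℕ → TL 2 (n + 1) := fun i => if h : i < n then TL.t 2 (n + 1) ⟨i, h⟩ - 1 else 1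
    have hT : ∀ i (h : i < n), T i = TL.t 2 (n + 1) ⟨i, h⟩ - 1 := fun i h => dif_pos h
    obtain ⟨φ, hφ⟩ := exists_permHom n T
      { sq := by
          intro i h
          have h1 := TL.t_sq 2 (n := n + 1) ⟨i, h⟩
          rw [hT i h, mul_sub, sub_mul, h1, two_smul]
          noncomm_ring
        braid := by
          intro i h
          have h1 := TL.t_sq 2 (n := n + 1) ⟨i, by simp; omega⟩
          have h2 := TL.t_sq 2 (n := n + 1) ⟨i + 1, h⟩
          have h3 := TL.t_braid 2 (n := n + 1) ⟨i, by simp; omega⟩ ⟨i + 1, h⟩ (by simp)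
          have h4 := TL.t_braid 2 (n := n + 1) ⟨i + 1, h⟩ ⟨i, by simp; omega⟩ (by simp)
          rw [hT i (by omega), hT (i + 1) h]
          generalize TL.t 2 (n + 1) ⟨i, _⟩ = a at *
          generalize TL.t 2 (n + 1) ⟨i + 1, _⟩ = b at *
          rw [two_smul] at h1 h2
          have e1 : (a - 1) * (b - 1) * (a - 1) =
            a * b * a - a * b - b * a + b - a * a + a + a - 1 := by
            simp only [mul_sub, sub_mul, mul_one, one_mul]; abel
          have e2 : (b - 1) * (a - 1) * (b - 1) =
            b * a * b - a * b - b * a + a - b * b + b + b - 1 := by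
            simp only [mul_sub, sub_mul, mul_one, one_mul]; abel
          rw [e1, e2, h1, h2, h3, h4]
          abel
        comm := by
          intro i j h hj
          rw [hT i (by omega), hT j hj]
          have h1 := TL.t_comm 2 (n := n + 1) ⟨i, by simp; omega⟩ ⟨j, hj⟩ (by simp; omega)
          simp only [mul_sub, sub_mul, mul_one, one_mul, h1]; abel }
    refine ⟨φ, fun i => ?_⟩
    rw [← hT i i.2, ← hφ i]
    rfl

/-- The homomorphism of algebras `θ : ℂ[S_n] → TL_n(2)` with `θ(s_i) = t_i - 1`. Permutations are
composed from left to right, so `S_n` is the opposite of Mathlib's group of permutations. -/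
noncomputable def theta (n : ℕ) : MonoidAlgebra ℂ (Equiv.Perm (Fin n))ᵐᵒᵖ →ₐ[ℂ] TL 2 n :=
  Classical.choose (exists_theta n)

theorem theta_simpleTransposition {n : ℕ} (i : Fin (n - 1)) :
    theta n (MonoidAlgebra.of ℂ _ (MulOpposite.op (simpleTransposition i))) = TL.t 2 n i - 1 :=
  Classical.choose_spec (exists_theta n) i

/-- `f_τ(w)`, the coefficient of the diagram `τ` in `θ(w)`. -/
noncomputable def tlCoeff {n : ℕ} (τ : KauffmanDiagram n) (w : Equiv.Perm (Fin n)) : ℂ :=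
  (theta n (MonoidAlgebra.of ℂ _ (MulOpposite.op w))).expand τ

/-- The `f`-immanant of a matrix. -/
def immanant {A : Type*} [CommRing A] [Algebra ℂ A] {n : ℕ} (f : Equiv.Perm (Fin n) → ℂ)
    (M : Matrix (Fin n) (Fin n) A) : A :=
  ∑ w : Equiv.Perm (Fin n), f w • ∏ i, M i (w i)

/-- The Temperley--Lieb immanant for the Kauffman diagram `τ`. -/
noncomputable def tlImmanant {A : Type*} [CommRing A] [Algebra ℂ A] {n : ℕ}
    (τ : KauffmanDiagram n) (M : Matrix (Fin n) (Fin n) A) : A :=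
  immanant (tlCoeff τ) M

end TemperleyLieb

section SkewShapes

/-- A skew shape `λ/μ`, given by the pair of partitions `μ ⊆ λ`. Rows and columns of Young diagrams
are numbered from `0`, so `outer.rowLen i` is `λ_{i+1}`. -/
@[ext]
structure SkewShape where
  outer : YoungDiagram
  inner : YoungDiagram
  le : inner ≤ outer

namespace SkewShape

/-- The cells of `λ/μ`, as pairs (row, column). -/
def cells (R : SkewShape) : Finset (ℕ × ℕ) := R.outer.cells \ R.inner.cells

/-- The number of cells. -/
def size (R : SkewShape) : ℕ := R.cells.card

/-- The length `ℓ(λ)`, the number of nonzero parts of the outer partition. -/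
def length (R : SkewShape) : ℕ := R.outer.colLen 0

/-- The conjugate `λ'/μ'`. -/
def conjugate (R : SkewShape) : SkewShape where
  outer := R.outer.transpose
  inner := R.inner.transpose
  le := YoungDiagram.transpose_le_iff.mpr R.le

/-- Two cells share an edge. -/
def Adjacent (a b : ℕ × ℕ) : Prop :=
  (a.1 = b.1 ∧ (a.2 + 1 = b.2 ∨ b.2 + 1 = a.2)) ∨ (a.2 = b.2 ∧ (a.1 + 1 = b.1 ∨ b.1 + 1 = a.1))

/-- Any two cells are joined by a chain of adjacent cells. -/
def IsConnected (R : SkewShape) : Prop :=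
  ∀ a ∈ R.cells, ∀ b ∈ R.cells, Relation.ReflTransGen (fun c d => d ∈ R.cells ∧ Adjacent c d) a b

/-- A ribbon: a connected skew shape that contains no `2 × 2` block of cells. -/
def IsRibbon (R : SkewShape) : Prop :=
  R.IsConnected ∧ ∀ i j, ¬ ((i, j) ∈ R.cells ∧ (i, j + 1) ∈ R.cells ∧
    (i + 1, j) ∈ R.cells ∧ (i + 1, j + 1) ∈ R.cells)

/-- The set `𝓡_m` of ribbons `λ/μ` of size `m` with `{i : λ_i > μ_i} = [ℓ(λ)]`. -/
def ribbons (m : ℕ) : Set SkewShape :=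
  {R | R.IsRibbon ∧ R.size = m ∧ ∀ i, R.inner.rowLen i < R.outer.rowLen i ↔ i < R.length}

/-- The label of a cell of a ribbon when its cells are labelled sequentially by `1, 2, …`, starting
from the top-right cell: the number of cells that are in a higher row, or in the same row and not
further left. -/
def label (R : SkewShape) (c : ℕ × ℕ) : ℕ :=
  (R.cells.filter fun d => d.1 < c.1 ∨ (d.1 = c.1 ∧ c.2 ≤ d.2)).card

/-- The descent set of a ribbon: the `i` such that the cell labelled `i` is immediately above the
cell labelled `i + 1`. -/
def Des (R : SkewShape) : Set ℕ :=
  {i | ∃ r c, (r, c) ∈ R.cells ∧ (r + 1, c) ∈ R.cells ∧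
    R.label (r, c) = i ∧ R.label (r + 1, c) = i + 1}

/-- `d(J, R) = {∑_{j=1}^i (λ_j - μ_j) : i ∈ J}`. -/
def d (J : Set ℕ) (R : SkewShape) : Set ℕ :=
  (fun i => ∑ j ∈ Finset.range i, (R.outer.rowLen j - R.inner.rowLen j)) '' J

end SkewShape

end SkewShapes

section SymmetricFunctions

variable {σ : Type*}

open Classical in
/-- The elementary symmetric function `e_d(x_1, x_2, …)`, as a formal power series, in the infinite
sequence of variables `x : ℕ ↪ σ`: the sum of all products of `d` distinct variables of the
sequence. In particular `e_0 = 1`, and `e_d = 0` for `d < 0`. -/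
noncomputable def elemSymm (x : ℕ ↪ σ) (d : ℤ) : MvPowerSeries σ ℂ :=
  fun a => if (a.degree : ℤ) = d ∧ (∀ v, a v ≤ 1) ∧ (∀ v ∈ a.support, v ∈ Set.range x)
    then 1 else 0

/-- The (dual) Jacobi--Trudi matrix `JT^n_{λ/μ}(x) = (e_{λ_i - μ_j - i + j}(x))_{i,j=1}^n`. -/
noncomputable def JT (n : ℕ) (R : SkewShape) (x : ℕ ↪ σ) :
    Matrix (Fin n) (Fin n) (MvPowerSeries σ ℂ) :=
  Matrix.of fun i j =>
    elemSymm x ((R.outer.rowLen i : ℤ) - (R.inner.rowLen j : ℤ) - (i : ℤ) + (j : ℤ))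

/-- The skew Schur function
`s_{λ/μ}(x) = det (e_{λ'_i - μ'_j - i + j}(x))_{i,j=1}^{ℓ(λ')}`. -/
noncomputable def skewSchur (R : SkewShape) (x : ℕ ↪ σ) : MvPowerSeries σ ℂ :=
  (JT R.conjugate.length R.conjugate x).det

/-- The Hadamard (entrywise) product of a family of matrices. -/
def hadamardProd {A : Type*} [CommRing A] {k n : ℕ} (M : Fin k → Matrix (Fin n) (Fin n) A) :
    Matrix (Fin n) (Fin n) A :=
  Matrix.of fun i j => ∏ p, M p i j

/-- The sequence of variables `x^{(p)} = (x^{(p)}_1, x^{(p)}_2, …)`, among `k` disjoint infinite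
sequences of variables. -/
def alphabet {k : ℕ} (p : Fin k) : ℕ ↪ Fin k × ℕ :=
  ⟨fun j => (p, j), fun _ _ h => congrArg Prod.snd h⟩

end SymmetricFunctions

end TLImm

/-
A ribbon Jacobi–Trudi matrix is upper Hessenberg, and a term of its Leibniz expansion can only be
nonzero for a permutation that moves no point down by more than one. Such a permutation is
determined by the set `J` of its subdiagonal entries and is the product of the `s_i`, `i ∈ J`, in
increasing order, so `θ` sends it to `∏_{i ∈ J} (t_i - 1)`: the coefficient of `τ(I)` is
`(-1)^{|J \ I|}` if `I ⊆ J` and `0` otherwise. Each subdiagonal entry is `1` if `J ⊆ {1, …, ℓ - 1}`,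
and the other entries are indexed by the gaps between the partial row sums that `J` leaves. Hence
the immanant for `τ(I)` is MacMahon's alternating sum over the subsets of `d([ℓ - 1] \ I, R)`, and
the determinant for `R_I` is the same sum over the subsets of `Des(R_I)`.
-/

namespace TLImm

open Finset

section HessenbergPermutations

variable {n : ℕ}

theorem lo_lt_hi (i : Fin (n - 1)) : lo i < hi i := Nat.lt_succ_self _

/-- A permutation that moves no point down by more than one. For permutations of the index set of an
upper Hessenberg matrix, these are the only ones with a nonzero term in the Leibniz expansion. -/
def IsHessenberg (w : Equiv.Perm (Fin n)) : Prop := ∀ v : Fin n, (v : ℕ) ≤ w v + 1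

/-- The positions `i` such that `w` moves `i + 1` down to `i`. -/
def drops (w : Equiv.Perm (Fin n)) : Finset (Fin (n - 1)) := {i | w (hi i) = lo i}

theorem mem_drops {w : Equiv.Perm (Fin n)} {i : Fin (n - 1)} : i ∈ drops w ↔ w (hi i) = lo i := by
  simp [drops]

namespace IsHessenberg

variable {w w' : Equiv.Perm (Fin n)}

theorem le_apply (hw : IsHessenberg w) {v : Fin n} (hv : ∀ i ∈ drops w, hi i ≠ v) : v ≤ w v := by
  by_contra! hlt
  have hstep : (v : ℕ) = w v + 1 := le_antisymm (hw v) hlt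
  have hhi : hi ⟨w v, by omega⟩ = v := Fin.ext hstep.symm
  exact hv _ (mem_drops.2 (by rw [hhi]; rfl)) hhi

theorem apply_le_lo (hw : IsHessenberg w) {i : Fin (n - 1)} (hdrop : i ∉ drops w) {v : Fin n}
    (hv : v ≤ lo i) : w v ≤ lo i := by
  have hmaps : Set.MapsTo w.symm (Iic (lo i)) (Iic (lo i)) := fun u hu => by
    have hle := hw (w.symm u)
    rw [Equiv.apply_symm_apply] at hle
    rw [mem_coe, mem_Iic] at hu ⊢
    by_contra! hlt
    have hhi : w.symm u = hi i := Fin.ext (by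
      simp only [hi, lo, Fin.lt_def, Fin.le_def] at *; omega)
    have hlo : u = lo i := Fin.ext (by simp only [lo, Fin.lt_def, Fin.le_def] at *; omega)
    exact hdrop (mem_drops.2 (by rw [← hhi, Equiv.apply_symm_apply, hlo]))
  obtain ⟨u, hu, rfl⟩ := surjOn_of_injOn_of_card_le _ hmaps w.symm.injective.injOn le_rfl
    (mem_coe.2 (mem_Iic.2 hv))
  rw [Equiv.apply_symm_apply]
  exact mem_Iic.1 hu

theorem exists_drop (hw : IsHessenberg w) {v b : Fin n} (hvb : v ≤ b) (hb : b < w v) :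
    ∃ i ∈ drops w, lo i = b := by
  by_contra! hno
  let i : Fin (n - 1) := ⟨b, by have := (w v).2; omega⟩
  exact (hw.apply_le_lo (i := i) (fun h => hno i h rfl) hvb).not_gt hb

theorem apply_ne_lo {i : Fin (n - 1)} (hdrop : i ∈ drops w) {v : Fin n} (hv : hi i ≠ v) :
    lo i ≠ w v := fun h => hv (w.injective ((mem_drops.1 hdrop).trans h))

theorem apply_le_of_drops_eq (hw : IsHessenberg w) (hw' : IsHessenberg w')
    (h : drops w = drops w') (v : Fin n) : w v ≤ w' v := by
  by_cases hv : ∃ i ∈ drops w, hi i = v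
  · obtain ⟨i, hdrop, rfl⟩ := hv
    rw [mem_drops.1 hdrop, mem_drops.1 (h ▸ hdrop)]
  · push Not at hv
    by_contra! hlt
    obtain ⟨i, hdrop, hlo⟩ := hw.exists_drop (hw'.le_apply (h ▸ hv)) hlt
    exact apply_ne_lo (h ▸ hdrop) (hv i hdrop) hlo

theorem eq_of_drops_eq (hw : IsHessenberg w) (hw' : IsHessenberg w') (h : drops w = drops w') :
    w = w' :=
  Equiv.ext fun v => le_antisymm (hw.apply_le_of_drops_eq hw' h v)
    (hw'.apply_le_of_drops_eq hw h.symm v)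

end IsHessenberg

end HessenbergPermutations

section CoxeterElements

theorem sort_insert_of_forall_lt {α : Type*} [LinearOrder α] {s : Finset α} {a : α}
    (h : ∀ x ∈ s, x < a) : (insert a s).sort (· ≤ ·) = s.sort (· ≤ ·) ++ [a] := by
  refine List.Perm.eq_of_pairwise' (r := (· ≤ ·)) (pairwise_sort _ _) ?_ ?_
  · refine List.pairwise_append.2 ⟨pairwise_sort _ _, List.pairwise_singleton _ _, ?_⟩
    simpa using fun x hx => (h x hx).le
  · rw [← Multiset.coe_eq_coe, ← Multiset.coe_add, sort_eq, sort_eq,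
      insert_val_of_notMem fun ha => (h a ha).false, ← Multiset.singleton_add, add_comm,
      Multiset.coe_singleton]

variable {n : ℕ}

/-- The product of the simple transpositions `s_i`, `i ∈ J`, in increasing order, where permutations
are composed from left to right: a Coxeter element of the parabolic subgroup generated by them. -/
def coxeterElement (J : Finset (Fin (n - 1))) : Equiv.Perm (Fin n) :=
  (((J.sort (· ≤ ·)).map fun i => MulOpposite.op (simpleTransposition i)).prod).unop

theorem coxeterElement_empty : coxeterElement (∅ : Finset (Fin (n - 1))) = 1 := by
  simp [coxeterElement]

theorem coxeterElement_insert {J : Finset (Fin (n - 1))} {a : Fin (n - 1)} (h : ∀ i ∈ J, i < a) :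
    coxeterElement (insert a J) = simpleTransposition a * coxeterElement J := by
  simp [coxeterElement, sort_insert_of_forall_lt h]

theorem coxeterElement_apply_of_forall_hi_lt {J : Finset (Fin (n - 1))} {v : Fin n}
    (h : ∀ i ∈ J, hi i < v) : coxeterElement J v = v := by
  induction J using Finset.induction_on_max with
  | empty => rw [coxeterElement_empty, Equiv.Perm.one_apply]
  | insert a J ha ih =>
    have hav : hi a < v := h a (mem_insert_self a J)
    rw [coxeterElement_insert ha, Equiv.Perm.mul_apply,
      ih fun i hiJ => h i (mem_insert_of_mem hiJ), simpleTransposition,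
      Equiv.swap_apply_of_ne_of_ne ((lo_lt_hi a).trans hav).ne' hav.ne']

theorem coxeterElement_hi_of_forall_lt {J : Finset (Fin (n - 1))} {i : Fin (n - 1)}
    (h : ∀ j ∈ J, j < i) : coxeterElement J (hi i) = hi i :=
  coxeterElement_apply_of_forall_hi_lt fun j hj => Nat.succ_lt_succ (h j hj)

theorem isHessenberg_coxeterElement (J : Finset (Fin (n - 1))) :
    IsHessenberg (coxeterElement J) := by
  induction J using Finset.induction_on_max with
  | empty => intro v; simp [coxeterElement_empty]
  | insert a J ha ih =>
    intro v
    have hle := ih v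
    rw [coxeterElement_insert ha, Equiv.Perm.mul_apply, simpleTransposition,
      Equiv.swap_apply_def]
    split_ifs with hlo hhi
    · simp only [hlo, lo, hi] at *; omega
    · rw [(coxeterElement J).injective (hhi.trans (coxeterElement_hi_of_forall_lt ha).symm)]
      simp [lo, hi]
    · exact hle

theorem drops_coxeterElement (J : Finset (Fin (n - 1))) : drops (coxeterElement J) = J := by
  induction J using Finset.induction_on_max with
  | empty => ext i; simpa [mem_drops, coxeterElement_empty] using (lo_lt_hi i).ne'
  | insert a J ha ih =>
    ext i
    rw [mem_drops, coxeterElement_insert ha, Equiv.Perm.mul_apply, simpleTransposition,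
      Equiv.swap_apply_eq_iff, mem_insert]
    rcases lt_trichotomy i a with hlt | rfl | hgt
    · rw [Equiv.swap_apply_of_ne_of_ne, ← mem_drops, ih, or_iff_right hlt.ne] <;>
      · simp only [lo, hi, ne_eq, Fin.ext_iff, Fin.lt_def] at *; omega
    · simp [coxeterElement_hi_of_forall_lt ha]
    · rw [coxeterElement_hi_of_forall_lt fun j hj => (ha j hj).trans hgt]
      refine iff_of_false (fun h => ?_) (not_or.2 ⟨hgt.ne', fun h => (ha i h).asymm hgt⟩)
      rw [Equiv.swap_apply_def] at h
      split_ifs at h <;> simp only [lo, hi, Fin.ext_iff, Fin.lt_def] at * <;> omega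

theorem coxeterElement_injective : Function.Injective (coxeterElement (n := n)) :=
  Function.LeftInverse.injective drops_coxeterElement

theorem IsHessenberg.coxeterElement_drops {w : Equiv.Perm (Fin n)} (hw : IsHessenberg w) :
    coxeterElement (drops w) = w :=
  (isHessenberg_coxeterElement _).eq_of_drops_eq hw (drops_coxeterElement _)

theorem sign_coxeterElement (J : Finset (Fin (n - 1))) :
    Equiv.Perm.sign (coxeterElement J) = (-1) ^ #J := by
  induction J using Finset.induction_on_max with
  | empty => simp [coxeterElement_empty]
  | insert a J ha ih =>
    rw [coxeterElement_insert ha, map_mul, ih, simpleTransposition,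
      Equiv.Perm.sign_swap (lo_lt_hi a).ne, card_insert_of_notMem fun h => (ha a h).false,
      pow_succ']

end CoxeterElements

section TemperleyLiebCoefficients

variable {n : ℕ} {ξ : ℂ}

theorem tau_empty : tau (∅ : Finset (Fin (n - 1))) = KauffmanDiagram.one n := by simp [tau]

theorem tau_insert {I : Finset (Fin (n - 1))} {a : Fin (n - 1)} (h : ∀ i ∈ I, i < a) :
    tau (insert a I) = (tau I).mulGen a := by
  simp [tau, sort_insert_of_forall_lt h]

theorem tau_partner_inr_of_forall_hi_lt {I : Finset (Fin (n - 1))} {j : Fin n}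
    (h : ∀ i ∈ I, hi i < j) : (tau I).partner (Sum.inr j) = Sum.inl j := by
  induction I using Finset.induction_on_max with
  | empty => simp [tau_empty, KauffmanDiagram.one]
  | insert a I ha ih =>
    have haj : hi a < j := h a (mem_insert_self a I)
    have hIj := ih fun i hiI => h i (mem_insert_of_mem hiI)
    have hpartner : ∀ v, (tau I).partner (Sum.inr v) ≠ Sum.inr j := fun v hv => by
      have := (tau I).partner_partner (Sum.inr v)
      rw [hv, hIj] at this
      cases this
    rw [tau_insert ha, KauffmanDiagram.mulGen_apply, if_neg, if_neg, if_neg (hpartner _).symm,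
      if_neg (hpartner _).symm, hIj]
    · simpa using haj.ne'
    · simpa using ((lo_lt_hi a).trans haj).ne'

theorem tau_partner_inr_hi {I : Finset (Fin (n - 1))} {a : Fin (n - 1)} (h : ∀ i ∈ I, i < a) :
    (tau I).partner (Sum.inr (hi a)) = Sum.inl (hi a) :=
  tau_partner_inr_of_forall_hi_lt fun i hiI => Nat.succ_lt_succ (h i hiI)

/-- The index of an endpoint of a Kauffman diagram, on either side. It is used to recover `I` from
`tau I`. -/
def endpointIndex : Fin n ⊕ Fin n → Fin n := Sum.elim id id

theorem mem_iff_lo_lt_endpointIndex_tau_partner {I : Finset (Fin (n - 1))} {i : Fin (n - 1)} :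
    i ∈ I ↔ lo i < endpointIndex ((tau I).partner (Sum.inr (lo i))) := by
  induction I using Finset.induction_on_max with
  | empty => simp [tau_empty, KauffmanDiagram.one, endpointIndex]
  | insert a I ha ih =>
    have hhi := tau_partner_inr_hi ha
    rcases lt_trichotomy i a with hlt | rfl | hgt
    · rw [tau_insert ha, KauffmanDiagram.mulGen_apply, mem_insert, hhi,
        if_neg (c := Sum.inr (lo i) = Sum.inl (hi a)) (by simp),
        if_neg (by simpa [lo, Fin.ext_iff] using hlt.ne),
        if_neg (by simp only [lo, hi, Sum.inr.injEq, Fin.ext_iff, Fin.lt_def] at *; omega),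
        or_iff_right hlt.ne, ih]
      split_ifs with hlo
      · rw [hlo, KauffmanDiagram.partner_partner]
        exact iff_of_true hlt (Nat.lt_succ_of_lt hlt)
      · rfl
    · simp [tau_insert ha, KauffmanDiagram.mulGen_apply, endpointIndex, lo_lt_hi]
    · refine iff_of_false (fun h => ?_) (not_lt.2 ?_)
      · exact (mem_insert.1 h).elim hgt.ne' fun hiI => (ha i hiI).asymm hgt
      · rcases eq_or_ne (lo i) (hi a) with heq | hne
        · simp [tau_insert ha, KauffmanDiagram.mulGen_apply, heq, endpointIndex, (lo_lt_hi a).ne',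
            (lo_lt_hi a).le]
        · rw [tau_partner_inr_of_forall_hi_lt fun j hj => ?_]
          · rfl
          · have hja : j ≤ a := (mem_insert.1 hj).elim le_of_eq fun hjI => (ha j hjI).le
            simp only [lo, hi, ne_eq, Fin.ext_iff, Fin.lt_def, Fin.le_def] at *; omega

theorem tau_injective : Function.Injective (tau (n := n)) := fun I K h => by
  ext i
  rw [mem_iff_lo_lt_endpointIndex_tau_partner, h, ← mem_iff_lo_lt_endpointIndex_tau_partner]

theorem actGen_single_tau {I : Finset (Fin (n - 1))} {a : Fin (n - 1)} (h : ∀ i ∈ I, i < a)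
    (c : ℂ) : actGen ξ a (Finsupp.single (tau I) c) = Finsupp.single (tau (insert a I)) c := by
  have hloop : (tau I).partner (Sum.inr (lo a)) ≠ Sum.inr (hi a) := fun hpartner => by
    have := (tau I).partner_partner (Sum.inr (lo a))
    rw [hpartner, tau_partner_inr_hi h] at this
    cases this
  rw [actGen_single, tau_insert h, KauffmanDiagram.loopFactor, if_neg hloop, mul_one]

theorem TL.expand_mul_t_sub_one (x : TL ξ n) (a : Fin (n - 1)) :
    (x * (TL.t ξ n a - 1)).expand = actGen ξ a x.expand - x.expand := by
  simp [TL.expand, mul_sub, TL.rightAction_t]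

theorem TL.expand_prod_t_sub_one (J : Finset (Fin (n - 1))) :
    ((J.sort (· ≤ ·)).map fun i => TL.t ξ n i - 1).prod.expand =
      ∑ I ∈ J.powerset, Finsupp.single (tau I) ((-1) ^ #(J \ I)) := by
  induction J using Finset.induction_on_max with
  | empty => simp [TL.expand, tau_empty]
  | insert a J ha ih =>
    have haJ : a ∉ J := fun h => (ha a h).false
    rw [sort_insert_of_forall_lt ha, List.map_append, List.prod_append, List.map_singleton,
      List.prod_singleton, TL.expand_mul_t_sub_one, ih, sum_powerset_insert haJ, map_sum,
      sub_eq_neg_add, ← sum_neg_distrib]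
    congr 1 <;> refine sum_congr rfl fun I hI => ?_ <;> rw [mem_powerset] at hI
    · rw [← Finsupp.single_neg, insert_sdiff_of_notMem _ fun h => haJ (hI h),
        card_insert_of_notMem (by simp [haJ]), pow_succ, mul_neg_one]
    · rw [actGen_single_tau fun i hiI => ha i (hI hiI), insert_sdiff_insert,
        sdiff_insert_of_notMem haJ]

theorem theta_coxeterElement (J : Finset (Fin (n - 1))) :
    theta n (MonoidAlgebra.of ℂ _ (MulOpposite.op (coxeterElement J))) =
      ((J.sort (· ≤ ·)).map fun i => TL.t 2 n i - 1).prod := by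
  simp only [coxeterElement, MulOpposite.op_unop, map_list_prod, List.map_map, Function.comp_def,
    theta_simpleTransposition]

theorem tlCoeff_tau_coxeterElement (I J : Finset (Fin (n - 1))) :
    tlCoeff (tau I) (coxeterElement J) = if I ⊆ J then (-1) ^ #(J \ I) else 0 := by
  classical
  rw [tlCoeff, theta_coxeterElement, TL.expand_prod_t_sub_one, Finsupp.finsetSum_apply]
  simp only [Finsupp.single_apply, tau_injective.eq_iff, sum_ite_eq', mem_powerset]

theorem tlCoeff_coxeterElement_eq_zero {τ : KauffmanDiagram n} {J : Finset (Fin (n - 1))}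
    (h : ∀ I ⊆ J, τ ≠ tau I) : tlCoeff τ (coxeterElement J) = 0 := by
  rw [tlCoeff, theta_coxeterElement, TL.expand_prod_t_sub_one, Finsupp.finsetSum_apply]
  exact sum_eq_zero fun I hI => Finsupp.single_eq_of_ne (h I (mem_powerset.1 hI))

end TemperleyLiebCoefficients

section HessenbergImmanants

/-- Upper Hessenberg matrices: all entries below the first subdiagonal vanish. -/
def IsUpperHessenberg {A : Type*} [Zero A] {n : ℕ} (M : Matrix (Fin n) (Fin n) A) : Prop :=
  ∀ i j : Fin n, (j : ℕ) + 1 < i → M i j = 0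

variable {A : Type*} [CommRing A] [Algebra ℂ A] {n : ℕ} {M : Matrix (Fin n) (Fin n) A}

theorem immanant_of_isUpperHessenberg (f : Equiv.Perm (Fin n) → ℂ)
    (hM : IsUpperHessenberg M) :
    immanant f M = ∑ J, f (coxeterElement J) • ∏ v, M v (coxeterElement J v) := by
  rw [immanant, ← sum_subset (subset_univ (univ.image (coxeterElement (n := n)))),
    sum_image coxeterElement_injective.injOn]
  intro w _ hw
  obtain ⟨v, hv⟩ : ∃ v, (w v : ℕ) + 1 < v := by
    by_contra! hess
    exact hw (mem_image.2 ⟨drops w, mem_univ _, IsHessenberg.coxeterElement_drops hess⟩)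
  rw [prod_eq_zero (mem_univ v) (hM v (w v) hv), smul_zero]

theorem tlImmanant_tau_of_isUpperHessenberg (I : Finset (Fin (n - 1)))
    (hM : IsUpperHessenberg M) :
    tlImmanant (tau I) M =
      ∑ J with I ⊆ J, (-1) ^ #(J \ I) * ∏ v, M v (coxeterElement J v) := by
  rw [tlImmanant, immanant_of_isUpperHessenberg _ hM, sum_filter]
  refine sum_congr rfl fun J _ => ?_
  rw [tlCoeff_tau_coxeterElement, ite_smul, zero_smul]
  congr 1
  rw [Algebra.smul_def, map_pow, map_neg, map_one]

theorem det_eq_immanant (M : Matrix (Fin n) (Fin n) A) :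
    M.det = immanant (fun w => ((Equiv.Perm.sign w : ℤ) : ℂ)) M := by
  rw [← Matrix.det_transpose, Matrix.det_apply, immanant]
  refine sum_congr rfl fun w _ => ?_
  rw [Units.smul_def, Int.cast_smul_eq_zsmul]
  rfl

theorem det_eq_tlImmanant_tau_empty_of_isUpperHessenberg
    (hM : IsUpperHessenberg M) : M.det = tlImmanant (tau ∅) M := by
  rw [det_eq_immanant, tlImmanant, immanant_of_isUpperHessenberg _ hM,
    immanant_of_isUpperHessenberg _ hM]
  refine sum_congr rfl fun J _ => ?_
  rw [tlCoeff_tau_coxeterElement, if_pos (empty_subset J), sdiff_empty, sign_coxeterElement]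
  norm_cast

theorem tlImmanant_eq_zero_of_isUpperHessenberg {τ : KauffmanDiagram n}
    (hM : IsUpperHessenberg M)
    (hτ : ∀ I : Finset (Fin (n - 1)), (∀ i ∈ I, M (hi i) (lo i) ≠ 0) → τ ≠ tau I) :
    tlImmanant τ M = 0 := by
  rw [tlImmanant, immanant_of_isUpperHessenberg _ hM]
  refine sum_eq_zero fun J _ => ?_
  by_cases hJ : ∀ i ∈ J, M (hi i) (lo i) ≠ 0
  · rw [tlCoeff_coxeterElement_eq_zero fun I hI => hτ I fun i hiI => hJ i (hI hiI), zero_smul]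
  · push Not at hJ
    obtain ⟨i, hiJ, hzero⟩ := hJ
    have hdrop : coxeterElement J (hi i) = lo i := mem_drops.1 ((drops_coxeterElement J).symm ▸ hiJ)
    rw [prod_eq_zero (mem_univ (hi i)) (by rw [hdrop, hzero]), smul_zero]

end HessenbergImmanants

section GapProducts

/-- The pairs of consecutive elements of a finite set of natural numbers. -/
def consecutivePairs (T : Finset ℕ) : Finset (ℕ × ℕ) :=
  {p ∈ T ×ˢ T | p.1 < p.2 ∧ ∀ c ∈ T, c ≤ p.1 ∨ p.2 ≤ c}

theorem mem_consecutivePairs {T : Finset ℕ} {a b : ℕ} :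
    (a, b) ∈ consecutivePairs T ↔ a ∈ T ∧ b ∈ T ∧ a < b ∧ ∀ c ∈ T, c ≤ a ∨ b ≤ c := by
  simp [consecutivePairs, and_assoc]

theorem consecutivePairs_snd_unique {T : Finset ℕ} {a b b' : ℕ} (h : (a, b) ∈ consecutivePairs T)
    (h' : (a, b') ∈ consecutivePairs T) : b = b' := by
  rw [mem_consecutivePairs] at h h'
  have := h.2.2.2 b' h'.2.1
  have := h'.2.2.2 b h.2.1
  omega

variable {A : Type*} [CommMonoid A]

/-- The product of `F a b` over all pairs of consecutive elements `a < b` of `T`: a product over the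
gaps of `T`. -/
def gapProd (T : Finset ℕ) (F : ℕ → ℕ → A) : A := ∏ p ∈ consecutivePairs T, F p.1 p.2

theorem exists_consecutivePairs_of_image {s : ℕ → ℕ} (hs : Monotone s) {T : Finset ℕ} {x y : ℕ}
    (hxy : (x, y) ∈ consecutivePairs (T.image s)) :
    ∃ a b, (a, b) ∈ consecutivePairs T ∧ s a = x ∧ s b = y := by
  obtain ⟨hx, hy, hlt, hgap⟩ := mem_consecutivePairs.1 hxy
  obtain ⟨a₀, ha₀, rfl⟩ := mem_image.1 hx
  obtain ⟨b₀, hb₀, rfl⟩ := mem_image.1 hy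
  obtain ⟨a, ha, hamax⟩ := exists_max_image {c ∈ T | s c ≤ s a₀} id ⟨a₀, by simp [ha₀]⟩
  obtain ⟨b, hb, hbmin⟩ := exists_min_image {c ∈ T | s b₀ ≤ s c} id ⟨b₀, by simp [hb₀]⟩
  rw [mem_filter] at ha hb
  refine ⟨a, b, mem_consecutivePairs.2 ⟨ha.1, hb.1, ?_, fun c hc => ?_⟩, ?_, ?_⟩
  · exact hs.reflect_lt ((ha.2.trans_lt hlt).trans_le hb.2)
  · exact (hgap (s c) (mem_image_of_mem s hc)).imp (fun h => hamax c (mem_filter.2 ⟨hc, h⟩))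
      fun h => hbmin c (mem_filter.2 ⟨hc, h⟩)
  · exact le_antisymm ha.2 (hs (hamax a₀ (by simp [ha₀])))
  · exact le_antisymm (hs (hbmin b₀ (by simp [hb₀]))) hb.2

theorem gapProd_image {s : ℕ → ℕ} (hs : Monotone s) {G : ℕ → ℕ → A} (hG : ∀ x, G x x = 1)
    (T : Finset ℕ) : gapProd T (fun a b => G (s a) (s b)) = gapProd (T.image s) G := by
  rw [gapProd, ← prod_filter_of_ne (p := fun p => s p.1 ≠ s p.2) fun p _ hne heq =>
    hne (by rw [heq, hG])]
  refine prod_bij (fun p _ => (s p.1, s p.2)) ?_ ?_ ?_ fun _ _ => rfl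
  · rintro ⟨a, b⟩ h
    rw [mem_filter, mem_consecutivePairs] at h
    obtain ⟨⟨ha, hb, hlt, hgap⟩, hne⟩ := h
    refine mem_consecutivePairs.2 ⟨mem_image_of_mem s ha, mem_image_of_mem s hb,
      lt_of_le_of_ne (hs hlt.le) hne, forall_mem_image.2 fun c hc => ?_⟩
    exact (hgap c hc).imp (fun h => hs h) fun h => hs h
  · rintro ⟨a, b⟩ h ⟨a', b'⟩ h' heq
    rw [mem_filter] at h h'
    obtain ⟨ha, -, -, hgap⟩ := mem_consecutivePairs.1 h.1
    obtain ⟨ha', -, -, hgap'⟩ := mem_consecutivePairs.1 h'.1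
    obtain ⟨hsa, hsb⟩ := Prod.mk.inj heq
    have hbot : a = a' := by
      refine le_antisymm ((hgap' a ha).resolve_right fun hle => ?_)
        ((hgap a' ha').resolve_right fun hle => ?_)
      · exact h.2 (le_antisymm (hs (mem_consecutivePairs.1 h.1).2.2.1.le) (hsb ▸ hs hle))
      · exact h'.2 (le_antisymm (hs (mem_consecutivePairs.1 h'.1).2.2.1.le) (hsb ▸ hs hle))
    subst hbot
    rw [consecutivePairs_snd_unique h.1 h'.1]
  · rintro ⟨x, y⟩ hxy
    obtain ⟨a, b, hab, rfl, rfl⟩ := exists_consecutivePairs_of_image hs hxy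
    exact ⟨(a, b), mem_filter.2 ⟨hab, (mem_consecutivePairs.1 hxy).2.2.1.ne⟩, rfl⟩

namespace IsHessenberg

variable {n : ℕ} {w : Equiv.Perm (Fin n)}

theorem mem_consecutivePairs_apply (hw : IsHessenberg w) {v : Fin n}
    (hv : ∀ i ∈ drops w, hi i ≠ v) :
    ((v : ℕ), (w v : ℕ) + 1) ∈
      consecutivePairs {u ∈ range (n + 1) | ∀ i ∈ drops w, (i : ℕ) + 1 ≠ u} := by
  refine mem_consecutivePairs.2 ⟨?_, ?_, Nat.lt_succ_of_le (hw.le_apply hv), fun c hc => ?_⟩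
  · exact mem_filter.2 ⟨mem_range.2 (by omega), fun i hdrop heq => hv i hdrop (Fin.ext heq)⟩
  · exact mem_filter.2 ⟨mem_range.2 (by omega), fun i hdrop heq =>
      apply_ne_lo hdrop (hv i hdrop) (Fin.ext (Nat.succ_injective heq))⟩
  · by_contra! hbetween
    obtain ⟨i, hdrop, hlo⟩ := hw.exists_drop (v := v) (b := ⟨c - 1, by omega⟩)
      (Nat.le_sub_one_of_lt hbetween.1) (Fin.lt_def.2 (by simp only; omega))
    refine (mem_filter.1 hc).2 i hdrop ?_
    have := congrArg Fin.val hlo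
    simp only [lo] at this
    omega

theorem prod_eq_gapProd (hw : IsHessenberg w) {F : ℕ → ℕ → A} (hF : ∀ x, F x x = 1) :
    ∏ v : Fin n, F v (w v + 1) =
      gapProd {u ∈ range (n + 1) | ∀ i ∈ drops w, (i : ℕ) + 1 ≠ u} F := by
  have hdrop : ∀ v : Fin n, F v (w v + 1) ≠ 1 → ∀ i ∈ drops w, hi i ≠ v := by
    rintro _ hne i hmem rfl
    exact hne (by rw [mem_drops.1 hmem]; exact hF _)
  rw [← prod_filter_of_ne fun v _ => hdrop v]
  refine prod_bij (fun v _ => ((v : ℕ), (w v : ℕ) + 1))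
    (fun v hv => hw.mem_consecutivePairs_apply (mem_filter.1 hv).2)
    (fun v _ v' _ h => Fin.ext (Prod.mk.inj h).1) ?_ fun _ _ => rfl
  rintro ⟨a, b⟩ hab
  obtain ⟨ha, hb, hlt, -⟩ := mem_consecutivePairs.1 hab
  have han : a < n := hlt.trans_le (Nat.le_of_lt_succ (mem_range.1 (mem_filter.1 hb).1))
  have hstart : ∀ i ∈ drops w, hi i ≠ ⟨a, han⟩ := fun i hmem heq =>
    (mem_filter.1 ha).2 i hmem (congrArg Fin.val heq)
  refine ⟨⟨a, han⟩, mem_filter.2 ⟨mem_univ _, hstart⟩, ?_⟩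
  rw [consecutivePairs_snd_unique hab (hw.mem_consecutivePairs_apply hstart)]

end IsHessenberg

end GapProducts

section SkewShapes

namespace SkewShape

variable (R : SkewShape)

theorem mem_cells_iff {i j : ℕ} :
    (i, j) ∈ R.cells ↔ R.inner.rowLen i ≤ j ∧ j < R.outer.rowLen i := by
  rw [cells, mem_sdiff, YoungDiagram.mem_cells, YoungDiagram.mem_cells,
    YoungDiagram.mem_iff_lt_rowLen, YoungDiagram.mem_iff_lt_rowLen, not_lt, and_comm]

theorem lt_length_iff {i : ℕ} : i < R.length ↔ 0 < R.outer.rowLen i := by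
  rw [length, ← YoungDiagram.mem_iff_lt_colLen, YoungDiagram.mem_iff_lt_rowLen]

theorem outer_rowLen_eq_zero {i : ℕ} (h : R.length ≤ i) : R.outer.rowLen i = 0 :=
  Nat.eq_zero_of_not_pos fun hpos => h.not_gt (R.lt_length_iff.2 hpos)

theorem inner_rowLen_le (i : ℕ) : R.inner.rowLen i ≤ R.outer.rowLen i := by
  by_contra! h
  have hcell : (i, R.outer.rowLen i) ∈ R.outer := R.le (YoungDiagram.mem_iff_lt_rowLen.2 h)
  exact (YoungDiagram.mem_iff_lt_rowLen.1 hcell).false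

theorem conjugate_conjugate : R.conjugate.conjugate = R := by
  simp [conjugate]

/-- The number of cells in the first `i` rows. -/
def rowSum (i : ℕ) : ℕ := ∑ j ∈ range i, (R.outer.rowLen j - R.inner.rowLen j)

theorem d_eq_image_rowSum (J : Set ℕ) : d J R = R.rowSum '' J := rfl

theorem rowSum_zero : R.rowSum 0 = 0 := rfl

theorem rowSum_succ (i : ℕ) :
    R.rowSum (i + 1) = R.rowSum i + (R.outer.rowLen i - R.inner.rowLen i) :=
  sum_range_succ _ _

theorem rowSum_mono : Monotone R.rowSum :=
  monotone_nat_of_le_succ fun i => R.rowSum_succ i ▸ Nat.le_add_right _ _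

theorem card_filter_row {i c : ℕ} (hc : R.inner.rowLen i ≤ c) :
    #{d ∈ R.cells | d.1 = i ∧ c ≤ d.2} = R.outer.rowLen i - c := by
  have hrow : {d ∈ R.cells | d.1 = i ∧ c ≤ d.2} = {i} ×ˢ Ico c (R.outer.rowLen i) := by
    ext ⟨a, b⟩
    simp only [mem_filter, mem_cells_iff, mem_product, mem_singleton, mem_Ico]
    constructor
    · rintro ⟨hcell, rfl, hcb⟩; exact ⟨rfl, hcb, hcell.2⟩
    · rintro ⟨rfl, hcb, hb⟩; exact ⟨⟨hc.trans hcb, hb⟩, rfl, hcb⟩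
  rw [hrow, card_product, card_singleton, Nat.card_Ico, one_mul]

theorem card_filter_rows_lt (i : ℕ) : #{d ∈ R.cells | d.1 < i} = R.rowSum i := by
  induction i with
  | zero => simp [rowSum]
  | succ i ih =>
    have hsplit : {d ∈ R.cells | d.1 < i + 1} =
        {d ∈ R.cells | d.1 < i} ∪ {d ∈ R.cells | d.1 = i ∧ R.inner.rowLen i ≤ d.2} := by
      rw [← filter_or]
      refine filter_congr fun ⟨a, b⟩ h => ?_
      rw [Nat.lt_succ_iff_lt_or_eq]
      refine or_congr_right (iff_self_and.2 ?_)
      rintro rfl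
      exact (R.mem_cells_iff.1 h).1
    rw [hsplit, card_union_of_disjoint (disjoint_filter.2 fun d _ h h' => h.ne h'.1), ih,
      R.card_filter_row le_rfl, rowSum_succ]

theorem label_eq {i c : ℕ} (hc : R.inner.rowLen i ≤ c) :
    R.label (i, c) = R.rowSum i + (R.outer.rowLen i - c) := by
  rw [label, filter_or, card_union_of_disjoint, card_filter_rows_lt, card_filter_row R hc]
  exact disjoint_filter.2 fun d _ h h' => h.ne h'.1

theorem rowSum_eq_size {i : ℕ} (hi : R.length ≤ i) : R.rowSum i = R.size := by
  rw [← card_filter_rows_lt, size, filter_true_of_mem]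
  rintro ⟨a, b⟩ h
  exact (R.lt_length_iff.2 (pos_of_gt (R.mem_cells_iff.1 h).2)).trans_le hi

variable {R}

theorem exists_vertical_step {i : ℕ} {a b : ℕ × ℕ} (ha : a ∈ R.cells) (hai : a.1 ≤ i)
    (hbi : i < b.1)
    (hab : Relation.ReflTransGen (fun c d => d ∈ R.cells ∧ Adjacent c d) a b) :
    ∃ c, (i, c) ∈ R.cells ∧ (i + 1, c) ∈ R.cells := by
  by_contra! hno
  suffices h : b ∈ R.cells ∧ b.1 ≤ i from hbi.not_ge h.2
  clear hbi
  induction hab with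
  | refl => exact ⟨ha, hai⟩
  | @tail b c _ hbc ih =>
    obtain ⟨b₁, b₂⟩ := b
    obtain ⟨c₁, c₂⟩ := c
    obtain ⟨hb, hbi⟩ := ih
    obtain ⟨hc, hadj⟩ := hbc
    refine ⟨hc, ?_⟩
    by_contra! hci
    simp only [Adjacent] at *
    obtain rfl : b₁ = i := by omega
    obtain rfl : c₁ = b₁ + 1 := by omega
    obtain rfl : b₂ = c₂ := by omega
    exact hno b₂ hb hc

variable {m : ℕ}

theorem inner_rowLen_lt (hR : R ∈ ribbons m) {i : ℕ} (h : i < R.length) :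
    R.inner.rowLen i < R.outer.rowLen i := (hR.2.2 i).2 h

theorem outer_rowLen_succ (hR : R ∈ ribbons m) {i : ℕ} (h : i + 1 < R.length) :
    R.outer.rowLen (i + 1) = R.inner.rowLen i + 1 := by
  obtain ⟨⟨hconn, hblock⟩, -, -⟩ := id hR
  have hi := inner_rowLen_lt hR (Nat.lt_of_succ_lt h)
  have hi' := inner_rowLen_lt hR h
  have houter := R.outer.rowLen_anti i (i + 1) i.le_succ
  have hinner := R.inner.rowLen_anti i (i + 1) i.le_succ
  have ha : (i, R.inner.rowLen i) ∈ R.cells := R.mem_cells_iff.2 ⟨le_rfl, hi⟩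
  have hb : (i + 1, R.inner.rowLen (i + 1)) ∈ R.cells := R.mem_cells_iff.2 ⟨le_rfl, hi'⟩
  obtain ⟨c, hc, hc'⟩ := exists_vertical_step (i := i) ha le_rfl i.lt_succ_self (hconn _ ha _ hb)
  rw [mem_cells_iff] at hc hc'
  by_contra hne
  refine hblock i (R.inner.rowLen i) ?_
  simp only [mem_cells_iff]
  omega

theorem rowSum_strictMonoOn (hR : R ∈ ribbons m) : StrictMonoOn R.rowSum (Set.Iic R.length) := by
  refine strictMonoOn_Iic_of_lt_succ fun i hi => ?_
  rw [Order.succ_eq_add_one, rowSum_succ]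
  exact Nat.lt_add_of_pos_right (Nat.sub_pos_of_lt (inner_rowLen_lt hR hi))

theorem Des_eq_d (hR : R ∈ ribbons m) : R.Des = d (Set.Icc 1 (R.length - 1)) R := by
  ext x
  constructor
  · rintro ⟨r, c, hc, hc', hx, -⟩
    rw [mem_cells_iff] at hc hc'
    have hr : r + 1 < R.length := R.lt_length_iff.2 (by omega)
    have hstep := outer_rowLen_succ hR hr
    obtain rfl : c = R.inner.rowLen r := by omega
    rw [label_eq R le_rfl, ← rowSum_succ] at hx
    exact ⟨r + 1, ⟨by omega, by omega⟩, hx⟩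
  · rintro ⟨i, ⟨hi, hi'⟩, rfl⟩
    obtain ⟨r, rfl⟩ : ∃ r, i = r + 1 := ⟨i - 1, by omega⟩
    have hstep := outer_rowLen_succ hR (show r + 1 < R.length by omega)
    have hr := inner_rowLen_lt hR (show r < R.length by omega)
    have hr' := inner_rowLen_lt hR (show r + 1 < R.length by omega)
    refine ⟨r, R.inner.rowLen r, R.mem_cells_iff.2 ⟨le_rfl, hr⟩,
      R.mem_cells_iff.2 ⟨by omega, by omega⟩, ?_, ?_⟩
    · rw [label_eq R le_rfl, ← rowSum_succ]; rfl
    · rw [label_eq R (by omega), hstep, Nat.add_sub_cancel_left]; rfl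

theorem jacobiTrudi_index (hR : R ∈ ribbons m) {i j : ℕ} (hij : i ≤ j) (hj : j < R.length) :
    (R.outer.rowLen i : ℤ) - R.inner.rowLen j - i + j = R.rowSum (j + 1) - R.rowSum i := by
  induction j, hij using Nat.le_induction with
  | base =>
    have := inner_rowLen_lt hR hj
    rw [rowSum_succ]; omega
  | succ j _ ih =>
    have := ih (Nat.lt_of_succ_lt hj)
    have := outer_rowLen_succ hR hj
    have := inner_rowLen_lt hR hj
    rw [rowSum_succ]; omega

theorem jacobiTrudi_index_subdiagonal (hR : R ∈ ribbons m) {i : ℕ} (hi : i + 1 < R.length) :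
    (R.outer.rowLen (i + 1) : ℤ) - R.inner.rowLen i - (i + 1 : ℕ) + i = 0 := by
  have := outer_rowLen_succ hR hi
  omega

theorem jacobiTrudi_index_neg (hR : R ∈ ribbons m) {i j : ℕ} (hij : j + 1 < i) :
    (R.outer.rowLen i : ℤ) - R.inner.rowLen j - i + j < 0 := by
  have hanti := R.outer.rowLen_anti (j + 1) i hij.le
  by_cases h : j + 1 < R.length
  · have := outer_rowLen_succ hR h; omega
  · have := R.outer_rowLen_eq_zero (not_lt.1 h); omega

end SkewShape

end SkewShapes

section RibbonsWithGivenDescents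

namespace SkewShape

/-- The rim of a Young diagram: the cells whose diagonal successor is not in the diagram. -/
def rim (Y : YoungDiagram) : SkewShape where
  outer := Y
  inner :=
    { cells := {c ∈ Y.cells | c + (1, 1) ∈ Y.cells}
      isLowerSet := fun a b hba ha => by
        rw [mem_coe, mem_filter] at ha ⊢
        exact ⟨Y.isLowerSet hba ha.1, Y.isLowerSet (add_le_add_left hba _) ha.2⟩ }
  le := YoungDiagram.cells_subset_iff.1 (filter_subset _ _)

variable {Y : YoungDiagram}

theorem mem_cells_rim {c : ℕ × ℕ} : c ∈ (rim Y).cells ↔ c ∈ Y ∧ c + (1, 1) ∉ Y := by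
  simp only [rim, cells, mem_sdiff, YoungDiagram.mem_cells, mem_filter]
  tauto

theorem not_block_subset_rim (i j : ℕ) : ¬ ((i, j) ∈ (rim Y).cells ∧ (i, j + 1) ∈ (rim Y).cells ∧
    (i + 1, j) ∈ (rim Y).cells ∧ (i + 1, j + 1) ∈ (rim Y).cells) := fun h =>
  (mem_cells_rim.1 h.1).2 (mem_cells_rim.1 h.2.2.2).1

theorem inner_rowLen_lt_outer_rowLen_rim_iff {i : ℕ} :
    (rim Y).inner.rowLen i < (rim Y).outer.rowLen i ↔ i < (rim Y).length := by
  refine ⟨fun h => (lt_length_iff _).2 (pos_of_gt h), fun h => ?_⟩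
  have hpos : 0 < Y.rowLen i := (lt_length_iff _).1 h
  have hcell : (i, Y.rowLen i - 1) ∈ (rim Y).cells := mem_cells_rim.2
    ⟨YoungDiagram.mem_iff_lt_rowLen.2 (Nat.sub_one_lt hpos.ne'), fun hmem => by
      have hlt : Y.rowLen i - 1 + 1 < Y.rowLen (i + 1) := YoungDiagram.mem_iff_lt_rowLen.1 hmem
      have := Y.rowLen_anti i (i + 1) i.le_succ
      omega⟩
  exact ((mem_cells_iff _).1 hcell).1.trans_lt ((mem_cells_iff _).1 hcell).2

/-- The cell labelled `p + 1` in the ribbon of size `m` with descent set `D`: its row is the number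
of descents among the earlier labels and its column the number of non-descents among the later
ones. -/
def ribbonCell (D : Finset ℕ) (m p : ℕ) : ℕ × ℕ :=
  (#{q ∈ range p | q + 1 ∈ D}, #{q ∈ Ico p (m - 1) | q + 1 ∉ D})

variable {D : Finset ℕ} {m : ℕ}

theorem ribbonCell_fst_mono : Monotone fun p => (ribbonCell D m p).1 := fun _ _ h =>
  card_le_card (filter_subset_filter _ (range_subset_range.2 h))

theorem ribbonCell_snd_anti : Antitone fun p => (ribbonCell D m p).2 := fun _ _ h =>
  card_le_card (filter_subset_filter _ (Ico_subset_Ico_left h))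

theorem ribbonCell_fst_succ (p : ℕ) :
    (ribbonCell D m (p + 1)).1 = (ribbonCell D m p).1 + if p + 1 ∈ D then 1 else 0 := by
  simp only [ribbonCell, card_filter, sum_range_succ]

theorem ribbonCell_snd_succ {p : ℕ} (hp : p + 1 < m) :
    (ribbonCell D m p).2 = (ribbonCell D m (p + 1)).2 + if p + 1 ∈ D then 0 else 1 := by
  simp only [ribbonCell, card_filter, sum_eq_sum_Ico_succ_bot (show p < m - 1 by omega), ite_not]
  exact add_comm _ _

theorem ribbonCell_snd_add {p : ℕ} (hp : p < m) :
    (ribbonCell D m p).2 + p = (ribbonCell D m p).1 + (ribbonCell D m 0).2 := by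
  induction p with
  | zero => simp [ribbonCell]
  | succ p ih =>
    have := ih (Nat.lt_of_succ_lt hp)
    have hfst := ribbonCell_fst_succ (D := D) (m := m) p
    have hsnd := ribbonCell_snd_succ (D := D) hp
    split_ifs at hfst hsnd <;> omega

theorem ribbonCell_injOn : Set.InjOn (ribbonCell D m) (range m : Set ℕ) := by
  intro p hp q hq h
  rw [mem_coe, mem_range] at hp hq
  have hpadd := ribbonCell_snd_add (D := D) hp
  have hqadd := ribbonCell_snd_add (D := D) hq
  rw [h] at hpadd
  omega

/-- The ribbon of size `m` with descent set `D`: the rim of the Young diagram generated by the cells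
`ribbonCell D m p`, `p < m`. -/
def ofDescents (D : Finset ℕ) (m : ℕ) : SkewShape :=
  rim
    { cells := (range m).biUnion fun p => Iic (ribbonCell D m p)
      isLowerSet := fun a b hba ha => by
        simp only [coe_biUnion, Set.mem_iUnion, mem_coe, mem_Iic] at ha ⊢
        exact ha.imp fun p hp => hp.imp fun _ hle => hba.trans hle }

theorem cells_ofDescents : (ofDescents D m).cells = (range m).image (ribbonCell D m) := by
  ext ⟨i, j⟩
  simp only [ofDescents, mem_cells_rim, ← YoungDiagram.mem_cells, mem_biUnion, mem_range, mem_Iic,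
    mem_image, not_exists, not_and, Prod.le_def, Prod.mk_add_mk, Prod.ext_iff]
  constructor
  · rintro ⟨⟨p, hp, hi, hj⟩, hdiag⟩
    have hpadd := ribbonCell_snd_add (D := D) hp
    have hlast := ribbonCell_snd_add (D := D) (show m - 1 < m by omega)
    have hlast_snd : (ribbonCell D m (m - 1)).2 = 0 := by simp [ribbonCell]
    have hfst := ribbonCell_fst_mono (D := D) (m := m) (show p ≤ m - 1 by omega)
    have hsnd := ribbonCell_snd_anti (D := D) (m := m) (Nat.zero_le p)
    simp only at hfst hsnd
    obtain ⟨q, hq⟩ : ∃ q, j + q = i + (ribbonCell D m 0).2 :=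
      ⟨i + (ribbonCell D m 0).2 - j, by omega⟩
    have hqm : q < m := by omega
    have hqadd := ribbonCell_snd_add (D := D) hqm
    have hqdiag := hdiag q hqm
    refine ⟨q, hqm, ?_⟩
    rcases le_total p q with h | h
    · have := ribbonCell_fst_mono (D := D) (m := m) h
      simp only at this; omega
    · have := ribbonCell_snd_anti (D := D) (m := m) h
      simp only at this; omega
  · rintro ⟨p, hp, rfl, rfl⟩
    refine ⟨⟨p, hp, le_rfl, le_rfl⟩, fun q _ hfst hsnd => ?_⟩
    rcases le_total p q with h | h
    · exact (ribbonCell_snd_anti h).not_gt hsnd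
    · exact (ribbonCell_fst_mono h).not_gt hfst

theorem ribbonCell_mem_cells {p : ℕ} (hp : p < m) : ribbonCell D m p ∈ (ofDescents D m).cells :=
  cells_ofDescents ▸ mem_image_of_mem _ (mem_range.2 hp)

theorem exists_ribbonCell_eq {c : ℕ × ℕ} (hc : c ∈ (ofDescents D m).cells) :
    ∃ p < m, ribbonCell D m p = c := by
  simpa [cells_ofDescents] using hc

theorem Adjacent.symm {a b : ℕ × ℕ} (h : Adjacent a b) : Adjacent b a := by
  simp only [Adjacent] at *
  omega

theorem adjacent_ribbonCell_succ {p : ℕ} (hp : p + 1 < m) :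
    Adjacent (ribbonCell D m p) (ribbonCell D m (p + 1)) := by
  have hfst := ribbonCell_fst_succ (D := D) (m := m) p
  have hsnd := ribbonCell_snd_succ (D := D) hp
  simp only [Adjacent]
  split_ifs at hfst hsnd <;> omega

theorem isConnected_ofDescents : (ofDescents D m).IsConnected := by
  intro a ha b hb
  obtain ⟨p, hp, rfl⟩ := exists_ribbonCell_eq ha
  obtain ⟨q, hq, rfl⟩ := exists_ribbonCell_eq hb
  refine Relation.ReflTransGen.lift (ribbonCell D m) (fun _ _ h => h) p q
    (reflTransGen_of_succ _ (fun r hr => ?_) fun r hr => ?_)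
  · have hrm : r + 1 < m := (Nat.succ_le_of_lt hr.2).trans_lt hq
    exact ⟨ribbonCell_mem_cells hrm, adjacent_ribbonCell_succ hrm⟩
  · have hrm : r + 1 < m := (Nat.succ_le_of_lt hr.2).trans_lt hp
    exact ⟨ribbonCell_mem_cells (Nat.lt_of_succ_lt hrm), (adjacent_ribbonCell_succ hrm).symm⟩

theorem ofDescents_mem_ribbons : ofDescents D m ∈ ribbons m := by
  refine ⟨⟨isConnected_ofDescents, not_block_subset_rim⟩, ?_,
    fun i => inner_rowLen_lt_outer_rowLen_rim_iff⟩
  rw [size, cells_ofDescents, card_image_of_injOn ribbonCell_injOn, card_range]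

theorem label_ofDescents {p : ℕ} (hp : p < m) :
    (ofDescents D m).label (ribbonCell D m p) = p + 1 := by
  have hbefore : {q ∈ range m | (ribbonCell D m q).1 < (ribbonCell D m p).1 ∨
      ((ribbonCell D m q).1 = (ribbonCell D m p).1 ∧
        (ribbonCell D m p).2 ≤ (ribbonCell D m q).2)} = range (p + 1) := by
    ext q
    rw [mem_filter, mem_range, mem_range, Nat.lt_succ_iff]
    constructor
    · rintro ⟨hq, hle⟩
      have hpadd := ribbonCell_snd_add (D := D) hp
      have hqadd := ribbonCell_snd_add (D := D) hq
      by_contra! hlt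
      have hfst := ribbonCell_fst_mono (D := D) (m := m) hlt.le
      simp only at hfst
      omega
    · exact fun hqp => ⟨hqp.trans_lt hp, (ribbonCell_fst_mono hqp).lt_or_eq.imp_right fun heq =>
        ⟨heq, ribbonCell_snd_anti hqp⟩⟩
  rw [label, cells_ofDescents, filter_image, card_image_of_injOn
    (ribbonCell_injOn.mono (coe_subset.2 (filter_subset _ _))), hbefore, card_range]

theorem Des_ofDescents (hD : ∀ x ∈ D, 1 ≤ x ∧ x < m) : (ofDescents D m).Des = D := by
  ext x
  constructor
  · rintro ⟨r, c, hcell, hcell', hlabel, hlabel'⟩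
    obtain ⟨p, hp, hpc⟩ := exists_ribbonCell_eq hcell
    obtain ⟨q, hq, hqc⟩ := exists_ribbonCell_eq hcell'
    rw [← hpc, label_ofDescents hp] at hlabel
    rw [← hqc, label_ofDescents hq] at hlabel'
    obtain rfl : q = p + 1 := by omega
    have hfst := ribbonCell_fst_succ (D := D) (m := m) p
    rw [hpc, hqc] at hfst
    by_contra hx
    rw [hlabel, if_neg (mt mem_coe.2 hx)] at hfst
    exact r.succ_ne_self hfst
  · intro hx
    obtain ⟨hpos, hxm⟩ := hD x hx
    obtain ⟨p, rfl⟩ : ∃ p, x = p + 1 := ⟨x - 1, by omega⟩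
    have hfst := ribbonCell_fst_succ (D := D) (m := m) p
    have hsnd := ribbonCell_snd_succ (D := D) hxm
    rw [if_pos (mem_coe.1 hx)] at hfst hsnd
    have hbelow : ribbonCell D m (p + 1) = ((ribbonCell D m p).1 + 1, (ribbonCell D m p).2) :=
      Prod.ext hfst hsnd.symm
    refine ⟨_, _, ribbonCell_mem_cells (Nat.lt_of_succ_lt hxm), ?_,
      label_ofDescents (Nat.lt_of_succ_lt hxm), ?_⟩
    · exact hbelow ▸ ribbonCell_mem_cells hxm
    · exact hbelow ▸ label_ofDescents hxm

end SkewShape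

end RibbonsWithGivenDescents

section RibbonJacobiTrudiMatrices

open SkewShape

variable {A : Type*} {m n : ℕ} {R : SkewShape} {E : ℤ → A}
  {I J : Finset (Fin (n - 1))}

/-- The Jacobi–Trudi matrix `(E_{λ_i - μ_j - i + j})` of a skew shape `λ/μ` for an arbitrary
sequence `E` in place of the elementary symmetric functions. The entrywise product of Jacobi–Trudi
matrices of the same shape is again of this form. -/
def jacobiTrudi (n : ℕ) (R : SkewShape) (E : ℤ → A) : Matrix (Fin n) (Fin n) A :=
  Matrix.of fun i j => E ((R.outer.rowLen i : ℤ) - R.inner.rowLen j - i + j)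

theorem jacobiTrudi_apply_coxeterElement (hR : R ∈ ribbons m)
    (hJ : ∀ i ∈ J, (i : ℕ) + 1 < R.length) (v : Fin n) :
    jacobiTrudi n R E v (coxeterElement J v) =
      E (R.rowSum (coxeterElement J v + 1) - R.rowSum v) := by
  rw [jacobiTrudi, Matrix.of_apply]
  by_cases hv : ∃ i ∈ J, hi i = v
  · obtain ⟨i, hiJ, rfl⟩ := hv
    rw [mem_drops.1 ((drops_coxeterElement J).symm ▸ hiJ)]
    simp only [hi, lo, jacobiTrudi_index_subdiagonal hR (hJ i hiJ), sub_self]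
  push Not at hv
  rcases lt_or_ge (v : ℕ) R.length with hlt | hge
  · have hess := isHessenberg_coxeterElement J
    rw [← drops_coxeterElement J] at hv hJ
    rw [jacobiTrudi_index hR (hess.le_apply hv)]
    by_contra! hlast
    obtain ⟨i, hdrop, hlo⟩ := hess.exists_drop (v := v) (b := ⟨R.length - 1, by omega⟩)
      (Nat.le_sub_one_of_lt hlt) (Fin.lt_def.2 (by simp only; omega))
    have hiR := hJ i hdrop
    have := congrArg Fin.val hlo
    simp only [lo] at this
    omega
  · have hle := R.inner_rowLen_le v
    have hzero := R.outer_rowLen_eq_zero hge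
    rw [coxeterElement_apply_of_forall_hi_lt fun i hiJ => (hJ i hiJ).trans_le hge,
      R.rowSum_eq_size hge, R.rowSum_eq_size (Nat.le_succ_of_le hge), sub_self]
    congr 1
    omega

variable (n R) in
/-- The rows of a skew shape other than the last one, among the positions of an `n × n` matrix. -/
def innerRows : Finset (Fin (n - 1)) := {i | (i : ℕ) + 1 < R.length}

theorem mem_innerRows {i : Fin (n - 1)} : i ∈ innerRows n R ↔ (i : ℕ) + 1 < R.length := by
  simp [innerRows]

variable (R) in
/-- The numbers of cells in the first `i + 1` rows, for `i ∈ J`; in a ribbon, these are the labels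
of the last cells of the rows in `J`. -/
def rowEnds (J : Finset (Fin (n - 1))) : Finset ℕ := J.image fun i : Fin (n - 1) => R.rowSum (i + 1)

theorem coe_rowEnds_sdiff (hn : R.length ≤ n) (I : Finset (Fin (n - 1))) :
    (rowEnds R (innerRows n R \ I) : Set ℕ) =
      d (Set.Icc 1 (R.length - 1) \ {j | ∃ i ∈ I, j = (i : ℕ) + 1}) R := by
  rw [rowEnds, coe_image, d_eq_image_rowSum,
    ← Set.image_image R.rowSum fun i : Fin (n - 1) => (i : ℕ) + 1]
  congr 1
  ext j
  simp only [Set.mem_image, mem_coe, mem_sdiff, mem_innerRows, Set.mem_sdiff, Set.mem_Icc,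
    Set.mem_ofPred_eq]
  constructor
  · rintro ⟨i, ⟨hiR, hiI⟩, rfl⟩
    refine ⟨⟨by omega, by omega⟩, ?_⟩
    rintro ⟨i', hi', heq⟩
    exact hiI (Fin.ext (Nat.succ_injective heq) ▸ hi')
  · rintro ⟨⟨hpos, hle⟩, hjI⟩
    exact ⟨⟨j - 1, by omega⟩, ⟨by simp only; omega, fun h => hjI ⟨_, h, by simp only; omega⟩⟩,
      Nat.sub_add_cancel hpos⟩

theorem coe_rowEnds_innerRows (hR : R ∈ ribbons m) (hn : R.length ≤ n) :
    (rowEnds R (innerRows n R) : Set ℕ) = R.Des := by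
  simpa [Des_eq_d hR] using coe_rowEnds_sdiff hn ∅

theorem injOn_rowSum_succ (hR : R ∈ ribbons m) :
    Set.InjOn (fun i : Fin (n - 1) => R.rowSum (i + 1)) (innerRows n R) := fun _ hi' _ hj heq =>
  Fin.ext (Nat.succ_injective ((rowSum_strictMonoOn hR).injOn (mem_innerRows.1 hi').le
    (mem_innerRows.1 hj).le heq))

theorem image_rowSum_eq_insert_rowEnds (hR : R ∈ ribbons m) (hn : R.length ≤ n) :
    image R.rowSum {u ∈ range (n + 1) | ∀ i ∈ J, (i : ℕ) + 1 ≠ u} =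
      insert 0 (insert m (rowEnds R (innerRows n R \ J))) := by
  have hsize {u : ℕ} (hu : R.length ≤ u) : R.rowSum u = m := (R.rowSum_eq_size hu).trans hR.2.1
  ext x
  simp only [mem_image, mem_filter, mem_range, mem_insert, rowEnds, mem_sdiff, mem_innerRows]
  constructor
  · rintro ⟨u, ⟨hun, huJ⟩, rfl⟩
    rcases Nat.eq_zero_or_pos u with rfl | hpos
    · exact Or.inl R.rowSum_zero
    rcases lt_or_ge u R.length with hlt | hge
    · obtain ⟨u, rfl⟩ := Nat.exists_eq_add_one_of_ne_zero hpos.ne'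
      exact Or.inr (Or.inr ⟨⟨u, by omega⟩, ⟨hlt, fun h => huJ _ h rfl⟩, rfl⟩)
    · exact Or.inr (Or.inl (hsize hge))
  · rintro (rfl | rfl | ⟨i, ⟨hiR, hiJ⟩, rfl⟩)
    · exact ⟨0, ⟨n.succ_pos, fun i _ => Nat.succ_ne_zero _⟩, R.rowSum_zero⟩
    · exact ⟨n, ⟨n.lt_succ_self, fun i _ => by omega⟩, hsize hn⟩
    · exact ⟨i + 1, ⟨by omega, fun j hj heq => hiJ (Fin.ext (Nat.succ_injective heq) ▸ hj)⟩, rfl⟩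

variable [CommRing A]

theorem isUpperHessenberg_jacobiTrudi (hR : R ∈ ribbons m) (hneg : ∀ d < 0, E d = 0) :
    IsUpperHessenberg (jacobiTrudi n R E) := fun _ _ hij => hneg _ (jacobiTrudi_index_neg hR hij)

theorem jacobiTrudi_hi_lo_eq_zero (hneg : ∀ d < 0, E d = 0) {i : Fin (n - 1)}
    (hi' : R.length ≤ (i : ℕ) + 1) : jacobiTrudi n R E (hi i) (lo i) = 0 := by
  have hrow : R.outer.rowLen (hi i) = 0 := R.outer_rowLen_eq_zero hi'
  rw [jacobiTrudi, Matrix.of_apply, hrow]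
  refine hneg _ ?_
  simp only [hi, lo]
  omega

theorem prod_jacobiTrudi_coxeterElement (hR : R ∈ ribbons m) (hn : R.length ≤ n) (h0 : E 0 = 1)
    (hJ : J ⊆ innerRows n R) :
    ∏ v, jacobiTrudi n R E v (coxeterElement J v) =
      gapProd (insert 0 (insert m (rowEnds R (innerRows n R \ J)))) fun a b => E (b - a) := by
  have hdiag (x : ℕ) : E ((x : ℤ) - x) = 1 := by rw [sub_self, h0]
  rw [← image_rowSum_eq_insert_rowEnds hR hn, ← gapProd_image R.rowSum_mono hdiag]
  have hprod := (isHessenberg_coxeterElement J).prod_eq_gapProd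
    (F := fun a b => E (R.rowSum b - R.rowSum a)) fun x => hdiag _
  rw [drops_coxeterElement] at hprod
  rw [← hprod]
  exact prod_congr rfl fun v _ =>
    jacobiTrudi_apply_coxeterElement hR (fun _ hi' => mem_innerRows.1 (hJ hi')) v

theorem prod_jacobiTrudi_coxeterElement_eq_zero (hneg : ∀ d < 0, E d = 0)
    (hJ : ¬ J ⊆ innerRows n R) : ∏ v, jacobiTrudi n R E v (coxeterElement J v) = 0 := by
  obtain ⟨i, hiJ, hi'⟩ := not_subset.1 hJ
  refine prod_eq_zero (mem_univ (hi i)) ?_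
  rw [mem_drops.1 ((drops_coxeterElement J).symm ▸ hiJ)]
  exact jacobiTrudi_hi_lo_eq_zero hneg (not_lt.1 (mt mem_innerRows.2 hi'))

/-- MacMahon's inclusion–exclusion formula for the ribbon of size `m` with descent set `D`: the
alternating sum of the products of `E` over the gaps between `0`, `m` and the elements of the
subsets of `D`. It is the ribbon Schur function when `E` is the sequence of elementary symmetric
functions, up to conjugation of the shape. -/
def ribbonSum (E : ℤ → A) (m : ℕ) (D : Finset ℕ) : A :=
  ∑ D' ∈ D.powerset, (-1) ^ #(D \ D') * gapProd (insert 0 (insert m D')) fun a b => E (b - a)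

theorem ribbonSum_rowEnds (hR : R ∈ ribbons m) {K : Finset (Fin (n - 1))}
    (hK : K ⊆ innerRows n R) :
    ribbonSum E m (rowEnds R K) = ∑ L ∈ K.powerset, (-1) ^ #(K \ L) *
      gapProd (insert 0 (insert m (rowEnds R L))) fun a b => E (b - a) := by
  have hinj := (injOn_rowSum_succ hR).mono (coe_subset.2 hK)
  rw [ribbonSum, rowEnds, powerset_image, sum_image (image_injOn_powerset_of_injOn hinj)]
  refine sum_congr rfl fun L hL => ?_
  rw [← image_sdiff_of_injOn hinj (mem_powerset.1 hL),
    card_image_of_injOn (hinj.mono (coe_subset.2 sdiff_subset)), rowEnds]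

variable [Algebra ℂ A]

theorem tlImmanant_tau_jacobiTrudi (hR : R ∈ ribbons m) (hn : R.length ≤ n) (h0 : E 0 = 1)
    (hneg : ∀ d < 0, E d = 0) (hI : I ⊆ innerRows n R) :
    tlImmanant (tau I) (jacobiTrudi n R E) = ribbonSum E m (rowEnds R (innerRows n R \ I)) := by
  set K := innerRows n R
  have hrestrict : ∑ J with I ⊆ J, (-1) ^ #(J \ I) * ∏ v, jacobiTrudi n R E v (coxeterElement J v) =
      ∑ J ∈ Icc I K, (-1) ^ #(J \ I) * ∏ v, jacobiTrudi n R E v (coxeterElement J v) := by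
    refine (sum_subset (fun J hJ => by simpa using (mem_Icc.1 hJ).1) fun J hJ hJK => ?_).symm
    rw [prod_jacobiTrudi_coxeterElement_eq_zero hneg fun h =>
      hJK (mem_Icc.2 ⟨(mem_filter.1 hJ).2, h⟩), mul_zero]
  rw [tlImmanant_tau_of_isUpperHessenberg I (isUpperHessenberg_jacobiTrudi hR hneg), hrestrict,
    ribbonSum_rowEnds hR sdiff_subset]
  refine sum_nbij' (K \ ·) (K \ ·) ?_ ?_ ?_ ?_ ?_
  · exact fun J hJ => mem_powerset.2 (sdiff_subset_sdiff le_rfl (mem_Icc.1 hJ).1)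
  · exact fun L hL => mem_Icc.2
      ⟨subset_sdiff.2 ⟨hI, (subset_sdiff.1 (mem_powerset.1 hL)).2.symm⟩, sdiff_subset⟩
  · exact fun J hJ => Finset.sdiff_sdiff_eq_self (mem_Icc.1 hJ).2
  · exact fun L hL => Finset.sdiff_sdiff_eq_self ((mem_powerset.1 hL).trans sdiff_subset)
  · intro J hJ
    rw [prod_jacobiTrudi_coxeterElement hR hn h0 (mem_Icc.1 hJ).2, sdiff_sdiff_comm,
      Finset.sdiff_sdiff_eq_self (mem_Icc.1 hJ).2]

theorem det_jacobiTrudi (hR : R ∈ ribbons m) (hn : R.length ≤ n) (h0 : E 0 = 1)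
    (hneg : ∀ d < 0, E d = 0) :
    (jacobiTrudi n R E).det = ribbonSum E m (rowEnds R (innerRows n R)) := by
  rw [det_eq_tlImmanant_tau_empty_of_isUpperHessenberg (isUpperHessenberg_jacobiTrudi hR hneg),
    tlImmanant_tau_jacobiTrudi hR hn h0 hneg (empty_subset _), sdiff_empty]

theorem tlImmanant_tau_jacobiTrudi_eq_det (hR : R ∈ ribbons m) (hn : R.length ≤ n)
    (hI : ∀ i ∈ I, (i : ℕ) + 1 < R.length) {RI : SkewShape} (hRI : RI ∈ ribbons m)
    (hDes : RI.Des = d (Set.Icc 1 (R.length - 1) \ {j | ∃ i ∈ I, j = (i : ℕ) + 1}) R) {N : ℕ}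
    (hN : RI.length ≤ N) (h0 : E 0 = 1) (hneg : ∀ d < 0, E d = 0) :
    tlImmanant (tau I) (jacobiTrudi n R E) = (jacobiTrudi N RI E).det := by
  rw [tlImmanant_tau_jacobiTrudi hR hn h0 hneg fun i hi' => mem_innerRows.2 (hI i hi'),
    det_jacobiTrudi hRI hN h0 hneg]
  congr 1
  rw [← coe_inj, coe_rowEnds_sdiff hn, coe_rowEnds_innerRows hRI hN, hDes]

theorem tlImmanant_jacobiTrudi_eq_zero (hR : R ∈ ribbons m) (hneg : ∀ d < 0, E d = 0)
    {τ : KauffmanDiagram n}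
    (hτ : ∀ I : Finset (Fin (n - 1)), (∀ i ∈ I, (i : ℕ) + 1 < R.length) → τ ≠ tau I) :
    tlImmanant τ (jacobiTrudi n R E) = 0 := by
  refine tlImmanant_eq_zero_of_isUpperHessenberg (isUpperHessenberg_jacobiTrudi hR hneg)
    fun I hI => hτ I fun i hiI => ?_
  by_contra! hge
  exact hI i hiI (jacobiTrudi_hi_lo_eq_zero hneg hge)

theorem exists_mem_ribbons_Des_eq (hR : R ∈ ribbons m) {J : Set ℕ}
    (hJ : J ⊆ Set.Icc 1 (R.length - 1)) : ∃ RI ∈ ribbons m, RI.Des = d J R := by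
  have hfin : (d J R).Finite := ((Set.finite_Icc _ _).subset hJ).image _
  refine ⟨ofDescents hfin.toFinset m, ofDescents_mem_ribbons, ?_⟩
  rw [Des_ofDescents, hfin.coe_toFinset]
  intro x hx
  obtain ⟨j, hj, rfl⟩ : x ∈ R.rowSum '' J := hfin.mem_toFinset.1 hx
  obtain ⟨hpos, hle⟩ := hJ hj
  have hlt : j < R.length := by omega
  refine ⟨(Nat.zero_le _).trans_lt
    (rowSum_strictMonoOn hR (Set.mem_Iic.2 (Nat.zero_le _)) hlt.le (Nat.zero_lt_of_lt hpos)), ?_⟩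
  rw [← hR.2.1, ← R.rowSum_eq_size le_rfl]
  exact rowSum_strictMonoOn hR hlt.le Set.self_mem_Iic hlt

end RibbonJacobiTrudiMatrices

section SymmetricFunctions

variable {σ : Type*} {k : ℕ}

theorem elemSymm_zero (x : ℕ ↪ σ) : elemSymm x 0 = 1 := by
  classical
  ext a
  rw [MvPowerSeries.coeff_one]
  change (if _ then _ else _) = _
  by_cases ha : a = 0
  · simp [ha]
  · rw [if_neg ha, if_neg]
    rintro ⟨hdeg, -⟩
    exact ha ((Finsupp.degree_eq_zero_iff a).1 (by exact_mod_cast hdeg))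

theorem elemSymm_neg (x : ℕ ↪ σ) {d : ℤ} (hd : d < 0) : elemSymm x d = 0 := by
  classical
  funext a
  refine if_neg ?_
  rintro ⟨hdeg, -⟩
  omega

theorem prod_elemSymm_zero (x : Fin k → ℕ ↪ σ) : ∏ p, elemSymm (x p) 0 = 1 :=
  prod_eq_one fun p _ => elemSymm_zero (x p)

theorem prod_elemSymm_neg (hk : 1 ≤ k) (x : Fin k → ℕ ↪ σ) {d : ℤ} (hd : d < 0) :
    ∏ p, elemSymm (x p) d = 0 :=
  prod_eq_zero (mem_univ ⟨0, hk⟩) (elemSymm_neg _ hd)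

theorem hadamardProd_JT (n : ℕ) (R : SkewShape) (x : Fin k → ℕ ↪ σ) :
    hadamardProd (fun p => JT n R (x p)) =
      jacobiTrudi n R fun d => ∏ p, elemSymm (x p) d := rfl

theorem JT_eq_jacobiTrudi (n : ℕ) (R : SkewShape) (x : ℕ ↪ σ) :
    JT n R x = jacobiTrudi n R (elemSymm x) := rfl

theorem skewSchur_conjugate (R : SkewShape) (x : ℕ ↪ σ) :
    skewSchur R.conjugate x = (jacobiTrudi R.length R (elemSymm x)).det := by
  rw [skewSchur, SkewShape.conjugate_conjugate, JT_eq_jacobiTrudi]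

end SymmetricFunctions

end TLImm

open TLImm TLImm.SkewShape in
theorem mainTheorem6_general {m n : ℕ} {R : SkewShape} (hR : R ∈ ribbons m) (hn : R.length ≤ n)
    {A : Type*} [CommRing A] [Algebra ℂ A] {E : ℤ → A} (h0 : E 0 = 1) (hneg : ∀ d < 0, E d = 0) :
    (∀ I : Finset (Fin (n - 1)), (∀ i ∈ I, (i : ℕ) + 1 < R.length) →
      (∃ RI ∈ ribbons m,
        RI.Des = d (Set.Icc 1 (R.length - 1) \ {j | ∃ i ∈ I, j = (i : ℕ) + 1}) R) ∧
      ∀ RI ∈ ribbons m,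
        RI.Des = d (Set.Icc 1 (R.length - 1) \ {j | ∃ i ∈ I, j = (i : ℕ) + 1}) R →
        ∀ N : ℕ, RI.length ≤ N →
          tlImmanant (tau I) (jacobiTrudi n R E) = (jacobiTrudi N RI E).det) ∧
    ∀ τ : KauffmanDiagram n,
      (∀ I : Finset (Fin (n - 1)), (∀ i ∈ I, (i : ℕ) + 1 < R.length) → τ ≠ tau I) →
      tlImmanant τ (jacobiTrudi n R E) = 0 :=
  ⟨fun _ hI => ⟨exists_mem_ribbons_Des_eq hR Set.sdiff_subset, fun _ hRI hDes _ hN =>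
    tlImmanant_tau_jacobiTrudi_eq_det hR hn hI hRI hDes hN h0 hneg⟩,
    fun _ hτ => tlImmanant_jacobiTrudi_eq_zero hR hneg hτ⟩

theorem mainTheorem6 (m n k : ℕ) (hk : 1 ≤ k) (R : TLImm.SkewShape)
    (hR : R ∈ TLImm.SkewShape.ribbons m) (hn : R.length ≤ n) :
    (∀ I : Finset (Fin (n - 1)), (∀ i ∈ I, (i : ℕ) + 1 < R.length) →
      (∃ RI ∈ TLImm.SkewShape.ribbons m, RI.Des =
        TLImm.SkewShape.d (Set.Icc 1 (R.length - 1) \ {j | ∃ i ∈ I, j = (i : ℕ) + 1}) R) ∧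
      ∀ RI ∈ TLImm.SkewShape.ribbons m, RI.Des =
          TLImm.SkewShape.d (Set.Icc 1 (R.length - 1) \ {j | ∃ i ∈ I, j = (i : ℕ) + 1}) R →
        (∀ N : ℕ, RI.length ≤ N →
          TLImm.tlImmanant (TLImm.tau I)
              (TLImm.hadamardProd fun p : Fin k => TLImm.JT n R (TLImm.alphabet p)) =
            (TLImm.hadamardProd fun p : Fin k => TLImm.JT N RI (TLImm.alphabet p)).det) ∧
        TLImm.tlImmanant (TLImm.tau I) (TLImm.JT n R (Function.Embedding.refl ℕ)) =
          TLImm.skewSchur RI.conjugate (Function.Embedding.refl ℕ)) ∧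
    (∀ τ : TLImm.KauffmanDiagram n,
      (∀ I : Finset (Fin (n - 1)), (∀ i ∈ I, (i : ℕ) + 1 < R.length) → τ ≠ TLImm.tau I) →
      TLImm.tlImmanant τ (TLImm.JT n R (Function.Embedding.refl ℕ)) = 0) := by
  have hprod := mainTheorem6_general hR hn
    (TLImm.prod_elemSymm_zero (TLImm.alphabet (k := k))) fun _ => TLImm.prod_elemSymm_neg hk _
  have hsingle := mainTheorem6_general hR hn
    (TLImm.elemSymm_zero (Function.Embedding.refl ℕ)) fun _ => TLImm.elemSymm_neg _
  refine ⟨fun I hI => ⟨(hprod.1 I hI).1, fun RI hRI hDes => ⟨fun N hN => ?_, ?_⟩⟩, hsingle.2⟩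
  · rw [TLImm.hadamardProd_JT, TLImm.hadamardProd_JT]
    exact (hprod.1 I hI).2 RI hRI hDes N hN
  · rw [TLImm.skewSchur_conjugate, TLImm.JT_eq_jacobiTrudi]
    exact (hsingle.1 I hI).2 RI hRI hDes RI.length le_rfl
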